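/- Conventions. $\log=\log_2$ and $\mathbb N=\{1,2,\dots\}$. Scalars are real or complex. For $0<r\le1$, an $r$-normed quasi-Banach space is a vector space that is complete for a definite, absolutely homogeneous function $\|\cdot\|\ge0$ with $\|x+y\|^r\le\|x\|^r+\|y\|^r$. For spaces $X_1,\dots,X_m$ of this kind, $l_p^m(X_i)$ is $X_1\times\dots\times X_m$ with $\|x\|=\big(\sum_i\|x_i\|^p\big)^{1/p}$ (and $\|x\|=\max_i\|x_i\|$ if $p=\infty$). For a bounded linear map $S:X\to Y$, $\|S\|=\sup_{\|x\|\le1}\|Sx\|$, and the entropy number $e_n(S)$ is the infimum of all $\varepsilon>0$ such that the image of the closed unit ball of $X$ can be covered by $2^{n-1}$ balls of radius $\varepsilon$ in $Y$ (with arbitrary centres). A maximum over the empty set is $0$. Theorem 3.3. Let $0<p<q\le\infty$, $\alpha=1/p-1/q$, $0<r\le1$, and let $m,n\in\mathbb N$ with $m\le2^n$. For $1\le i\le m$ let $X_i,Y_i$ be $r$-normed quasi-Banach spaces and $T_i:X_i\to Y_i$ bounded linear maps, and let $T:l_p^m(X_i)\to l_q^m(Y_i)$ be the diagonal operator $T(x_1,\dots,x_m)=(T_1x_1,\dots,T_mx_m)$.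 (i) Suppose that $m\ge2n$, $\|T_1\|\ge\|T_2\|\ge\dots\ge\|T_m\|$ and $\|T_1\|\le2\|T_n\|$. Put $$A(n,m)=\max_{n\le s\le m,\ s\le2^n}\|T_s\|\Big(\frac{\log(2s/n)}{n}\Big)^{\alpha},\qquad B(n,m)=\max_{1\le k\le n,\ 1\le i\le m}\Big(\frac kn\Big)^{\alpha}e_k(T_i).$$ Then $$c_1A(n,m)\le e_n(T)\le c_2\max\big(A(n,m),B(n,m)\big),$$ where $c_1>0$ depends only on $p,q,r$ and $c_2>0$ depends only on $p,q$. (ii) Suppose that $m\le n$ and that $X_i=X$, $Y_i=Y$ and $T_i=T_0$ for all $i$. For $a>0$ put $$D(a,n,m)=\max_{k\in\{1,\dots,n\},\ k\ge a}\Big(\frac kn\Big)^{\alpha}e_k(T_0).$$ Then $$c_5D(c_3n/m,n,m)\le e_n(T)\le c_6D(c_4n/m,n,m),$$ where $c_3,c_4>0$ are absolute constants, $c_5>0$ depends only on $p,q,r$ and $c_6>0$ depends only on $p,q$. -/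

import Mathlib

open scoped ENNReal

universe u v w

/-- `X`, with the function `‖·‖`, is an `r`-normed quasi-Banach space over `𝕜` (where `0 < r ≤ 1`):
`‖·‖` is definite, absolutely homogeneous, satisfies `‖x + y‖ ^ r ≤ ‖x‖ ^ r + ‖y‖ ^ r`, and every
Cauchy sequence converges. Only the bare function class `Norm` is used, because Mathlib's
`NormedAddCommGroup` would impose the triangle inequality. -/
class RBanachSpace (𝕜 : Type w) [RCLike 𝕜] (r : ℝ) (X : Type u) [AddCommGroup X] [Module 𝕜 X]
    [Norm X] : Prop where
  norm_nonneg : ∀ x : X, 0 ≤ ‖x‖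
  eq_zero_of_norm_eq_zero : ∀ x : X, ‖x‖ = 0 → x = 0
  norm_smul : ∀ (c : 𝕜) (x : X), ‖c • x‖ = ‖c‖ * ‖x‖
  norm_add_rpow_le : ∀ x y : X, ‖x + y‖ ^ r ≤ ‖x‖ ^ r + ‖y‖ ^ r
  complete : ∀ f : ℕ → X, (∀ ε : ℝ, 0 < ε → ∃ N : ℕ, ∀ k ≥ N, ∀ l ≥ N, ‖f k - f l‖ < ε) →
    ∃ x : X, Filter.Tendsto (fun k => ‖f k - x‖) Filter.atTop (nhds 0)

section Operators

variable {𝕜 : Type w} [RCLike 𝕜] {X : Type u} {Y : Type v}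
  [AddCommGroup X] [Module 𝕜 X] [Norm X] [AddCommGroup Y] [Module 𝕜 Y] [Norm Y]

/-- The linear map `T` is bounded, i.e. `T ∈ B(X, Y)`. -/
def IsBoundedOp (T : X →ₗ[𝕜] Y) : Prop :=
  ∃ C : ℝ, ∀ x : X, ‖T x‖ ≤ C * ‖x‖

/-- The operator quasi-norm `‖T‖ = sup {‖T x‖ : ‖x‖ ≤ 1}` (of a bounded linear map). -/
noncomputable def opQNorm (T : X →ₗ[𝕜] Y) : ℝ :=
  sSup {t : ℝ | ∃ x : X, ‖x‖ ≤ 1 ∧ t = ‖T x‖}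

/-- The `n`-th dyadic outer entropy number of a (bounded) set `M`, for `n ≥ 1`: the infimum of the
`ε > 0` such that `M` can be covered by `2 ^ (n - 1)` balls of radius `ε`, with arbitrary
centres. -/
noncomputable def setEntropyNumber (n : ℕ) (M : Set Y) : ℝ :=
  sInf {ε : ℝ | 0 < ε ∧ ∃ c : Fin (2 ^ (n - 1)) → Y, ∀ y ∈ M, ∃ j, ‖y - c j‖ ≤ ε}

/-- The `n`-th entropy number `e_n(T) = e_n(T(B_X))`, where `B_X` is the closed unit ball. -/
noncomputable def entropyNumber (n : ℕ) (T : X →ₗ[𝕜] Y) : ℝ :=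
  setEntropyNumber n (T '' {x : X | ‖x‖ ≤ 1})

end Operators

/-- The exponent `1/p - 1/q`, with `1/∞ = 0`. -/
noncomputable def expGap (p q : ℝ≥0∞) : ℝ := (p⁻¹).toReal - (q⁻¹).toReal

section Diagonal

variable {𝕜 : Type w} [RCLike 𝕜] {m : ℕ} {X : Fin m → Type u} {Y : Fin m → Type v}
  [∀ i, AddCommGroup (X i)] [∀ i, Module 𝕜 (X i)] [∀ i, Norm (X i)]
  [∀ i, AddCommGroup (Y i)] [∀ i, Module 𝕜 (Y i)] [∀ i, Norm (Y i)]

/-- The diagonal operator `(x_i) ↦ (T_i x_i)` from `l_p^m(X_i)` to `l_q^m(Y_i)`. Mathlib's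
`PiLp p X` carries exactly the quasi-norm `(∑ ‖x_i‖ ^ p) ^ (1 / p)`, or `sup ‖x_i‖` if `p = ∞`. -/
def diagOp (p q : ℝ≥0∞) (T : ∀ i, X i →ₗ[𝕜] Y i) : PiLp p X →ₗ[𝕜] PiLp q Y :=
  (WithLp.linearEquiv q 𝕜 (∀ i, Y i)).symm.toLinearMap ∘ₗ
    (LinearMap.pi fun i => T i ∘ₗ LinearMap.proj i) ∘ₗ
      (WithLp.linearEquiv p 𝕜 (∀ i, X i)).toLinearMap

/-- `max ‖T_s‖ (log₂(2 s / n) / n) ^ α` over `n ≤ s ≤ m`, `s ≤ 2 ^ n`. The operator `T_s`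
(`1 ≤ s ≤ m`) is the entry of `T` at the index `s - 1` of `Fin m`. -/
noncomputable def quantityA (α : ℝ) (n : ℕ) (T : ∀ i, X i →ₗ[𝕜] Y i) : ℝ :=
  sSup {a : ℝ | ∃ (s : ℕ) (i : Fin m), (i : ℕ) + 1 = s ∧ n ≤ s ∧ s ≤ 2 ^ n ∧
    a = opQNorm (T i) * (Real.logb 2 (2 * (s : ℝ) / (n : ℝ)) / (n : ℝ)) ^ α}

/-- `max (k / n) ^ α e_k(T_i)` over `1 ≤ k ≤ n`, `1 ≤ i ≤ m`. -/
noncomputable def quantityB (α : ℝ) (n : ℕ) (T : ∀ i, X i →ₗ[𝕜] Y i) : ℝ :=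
  sSup {b : ℝ | ∃ (k : ℕ) (i : Fin m), 1 ≤ k ∧ k ≤ n ∧
    b = ((k : ℝ) / (n : ℝ)) ^ α * entropyNumber k (T i)}

end Diagonal

/-- `max (k / n) ^ α e_k(T₀)` over the integers `1 ≤ k ≤ n` with `k ≥ a`; it is `0` if there is no
such `k`, i.e. if `a > n`. -/
noncomputable def quantityD {𝕜 : Type w} [RCLike 𝕜] {X : Type u} {Y : Type v}
    [AddCommGroup X] [Module 𝕜 X] [Norm X] [AddCommGroup Y] [Module 𝕜 Y] [Norm Y]
    (α : ℝ) (a : ℝ) (n : ℕ) (T₀ : X →ₗ[𝕜] Y) : ℝ :=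
  sSup {d : ℝ | ∃ k : ℕ, 1 ≤ k ∧ k ≤ n ∧ a ≤ (k : ℝ) ∧
    d = ((k : ℝ) / (n : ℝ)) ^ α * entropyNumber k T₀}

/-!
Both upper bounds and both lower bounds rest on one construction each. Throughout, `x` lies in the
unit ball of `l_p^m(X_i)`, the mass of its `i`-th coordinate is `w_i = ‖x_i‖ ^ p`, so that
`∑ w_i ≤ 1`, and `α = 1 / p - 1 / q`.

*Upper bounds.* Coordinate `i` is covered with a precision of about `n w_i / 16` bits, rounded down
to `0` below a threshold `κ_i` (`level`). A coordinate that receives `k` bits has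
`‖x_i‖ ≲ (k / n) ^ (1 / p)`, hence it is approximated up to
`(k / n) ^ (1 / p) e_k(T_i) = (k / n) ^ (1 / q) · (k / n) ^ α e_k(T_i)`; as `k / n ≤ w_i`, these
errors add up in `l_q` to at most a multiple of the maximum of the `(k / n) ^ α e_k(T_i)`
(`IsBoundedOp.exists_cover_level`). A generating function shows that all precision vectors together
need at most `2 ^ (n / 2)` centres as soon as `∑ 2 ^ (-κ_i) ≤ n / 16` (`sum_levelVectors_le`,
`entropyNumber_diagOp_le`). For decreasing norms, `κ_i ≈ 2 log (i / n)`, and the images of the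
coordinates below the threshold are replaced by `0`; the error is at most a multiple of
`‖T_i‖ (κ_i / n) ^ α w_i ^ (1 / q)`, which is controlled by the quantity `A`. For equal
operators, all coordinates get at least about `n / (8 m)` bits. No (quasi-)triangle inequality is
used here, so the constants do not depend on `r`.

*Lower bounds.* The coordinates are cut into `l` blocks, in each of which an alphabet of `Q` vectors
has separated images. Words of length `l`, scaled by `l ^ (-1 / p)`, lie in the unit ball. If
`Q ^ l ≥ 4 ^ (n + l)`, the pigeonhole principle and a count of Hamming balls give two words in a
common covering ball that differ in more than half of their letters, and hence the radius is at
least a multiple of `l ^ (-α)` times the separation (`le_entropyNumber_diagOp`). For `A`, a letter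
is a position in a block together with a multiple of a norming vector, and
`l ≈ 2 n / log (4 s / n)`; for `D`, the letters are `2 ^ (k - 1)` points with `e_k(T₀)`-separated
images, and `l ≈ 4 n / k`.
-/

/-! ### Quasi-normed spaces and bounded operators -/

namespace RBanachSpace

variable (𝕜 : Type w) [RCLike 𝕜] (r : ℝ) {X : Type u} [AddCommGroup X] [Module 𝕜 X] [Norm X]
  [RBanachSpace 𝕜 r X]

include 𝕜 r

theorem norm_zero : ‖(0 : X)‖ = 0 := by
  simpa using RBanachSpace.norm_smul r (0 : 𝕜) (0 : X)

theorem norm_neg (x : X) : ‖-x‖ = ‖x‖ := by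
  simpa using RBanachSpace.norm_smul r (-1 : 𝕜) x

theorem norm_real_smul {t : ℝ} (ht : 0 ≤ t) (x : X) : ‖(t : 𝕜) • x‖ = t * ‖x‖ := by
  rw [RBanachSpace.norm_smul r, RCLike.norm_ofReal, abs_of_nonneg ht]

/-- If `a` and `b` both lie in a ball, then `a - b` is longer than the radius by a factor of at
most `2 ^ (1 / r)`. -/
theorem exists_far_of_sub (hr : 0 < r) {a b c : X} {δ : ℝ} (hδ : 0 ≤ δ) (h : δ ≤ ‖a - b‖) :
    2 ^ (-(1 / r)) * δ ≤ ‖a - c‖ ∨ 2 ^ (-(1 / r)) * δ ≤ ‖b - c‖ := by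
  by_contra! hcon
  have h1 := RBanachSpace.norm_nonneg 𝕜 r (a - c)
  have h2 := RBanachSpace.norm_nonneg 𝕜 r (b - c)
  have h3 := norm_add_rpow_le (r := r) 𝕜 (a - c) (-(b - c))
  rw [RBanachSpace.norm_neg 𝕜 r, show a - c + -(b - c) = a - b by abel] at h3
  have e : (2 ^ (-(1 / r)) * δ : ℝ) ^ r = δ ^ r / 2 := by
    rw [Real.mul_rpow (by positivity) hδ, ← Real.rpow_mul (by norm_num),
      show -(1 / r) * r = -1 by field_simp, Real.rpow_neg_one]
    ring
  have h4 := Real.rpow_lt_rpow h1 hcon.1 hr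
  have h5 := Real.rpow_lt_rpow h2 hcon.2 hr
  have h6 := Real.rpow_le_rpow hδ h hr.le
  linarith

end RBanachSpace

section Operators

variable {𝕜 : Type w} [RCLike 𝕜] {r : ℝ} {X : Type u} {Y : Type v}
  [AddCommGroup X] [Module 𝕜 X] [Norm X] [AddCommGroup Y] [Module 𝕜 Y] [Norm Y]

/-- Sets covered by the balls of radius `ε` around at most `2 ^ (n - 1)` points have `n`-th entropy
number at most `ε`. -/
theorem setEntropyNumber_le {n : ℕ} {M : Set Y} {ε : ℝ} (hε : 0 < ε) (S : Finset Y)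
    (hS : S.card ≤ 2 ^ (n - 1)) (h : ∀ y ∈ M, ∃ c ∈ S, ‖y - c‖ ≤ ε) :
    setEntropyNumber n M ≤ ε := by
  refine csInf_le ⟨0, fun _ ht => ht.1.le⟩ ⟨hε, ?_⟩
  have : Fintype.card S ≤ Fintype.card (Fin (2 ^ (n - 1))) := by simpa using hS
  obtain ⟨e⟩ := Function.Embedding.nonempty_of_card_le this
  refine ⟨Function.extend e (fun s => s.1) 0, fun y hy => ?_⟩
  obtain ⟨c, hc, hyc⟩ := h y hy
  exact ⟨e ⟨c, hc⟩, by rwa [e.injective.extend_apply]⟩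

theorem entropyNumber_nonneg (n : ℕ) (T : X →ₗ[𝕜] Y) : 0 ≤ entropyNumber n T :=
  Real.sInf_nonneg fun _ ht => ht.1.le

section Bounded

variable {T : X →ₗ[𝕜] Y} (r)

theorem IsBoundedOp.exists_bound (hX : ∀ x : X, 0 ≤ ‖x‖) (hT : IsBoundedOp T) :
    ∃ C : ℝ, 0 < C ∧ ∀ x : X, ‖x‖ ≤ 1 → ‖T x‖ ≤ C := by
  obtain ⟨C, hC⟩ := hT
  refine ⟨|C| + 1, by positivity, fun x hx => (hC x).trans ?_⟩
  have := mul_le_mul_of_nonneg_right (le_abs_self C) (hX x)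
  have := mul_le_mul_of_nonneg_left hx (abs_nonneg C)
  linarith

theorem IsBoundedOp.bddAbove [RBanachSpace 𝕜 r X] (hT : IsBoundedOp T) :
    BddAbove {t : ℝ | ∃ x : X, ‖x‖ ≤ 1 ∧ t = ‖T x‖} := by
  obtain ⟨C, -, hC⟩ := hT.exists_bound (RBanachSpace.norm_nonneg 𝕜 r)
  exact ⟨C, by rintro _ ⟨x, hx, rfl⟩; exact hC x hx⟩

theorem opQNorm_nonneg [RBanachSpace 𝕜 r Y] : 0 ≤ opQNorm T :=
  Real.sSup_nonneg (by rintro _ ⟨x, hx, rfl⟩; exact RBanachSpace.norm_nonneg 𝕜 r _)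

theorem IsBoundedOp.norm_apply_le [RBanachSpace 𝕜 r X] [RBanachSpace 𝕜 r Y]
    (hT : IsBoundedOp T) (x : X) : ‖T x‖ ≤ opQNorm T * ‖x‖ := by
  rcases (RBanachSpace.norm_nonneg 𝕜 r x).eq_or_lt with h | h
  · rw [RBanachSpace.eq_zero_of_norm_eq_zero 𝕜 r x h.symm, map_zero, RBanachSpace.norm_zero 𝕜 r,
      RBanachSpace.norm_zero 𝕜 r, mul_zero]
  · have h1 : ‖T (((‖x‖⁻¹ : ℝ) : 𝕜) • x)‖ ≤ opQNorm T := by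
      refine le_csSup (hT.bddAbove r) ⟨_, ?_, rfl⟩
      rw [RBanachSpace.norm_real_smul 𝕜 r (by positivity), inv_mul_cancel₀ h.ne']
    rw [map_smul, RBanachSpace.norm_real_smul 𝕜 r (by positivity)] at h1
    rwa [inv_mul_le_iff₀ h, mul_comm] at h1

theorem exists_lt_norm_apply [RBanachSpace 𝕜 r X] {τ : ℝ} (h : τ < opQNorm T) :
    ∃ x : X, ‖x‖ ≤ 1 ∧ τ < ‖T x‖ := by
  obtain ⟨_, ⟨x, hx, rfl⟩, hlt⟩ := exists_lt_of_lt_csSup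
    (⟨_, 0, by rw [RBanachSpace.norm_zero 𝕜 r]; exact zero_le_one, rfl⟩ :
      {t : ℝ | ∃ x : X, ‖x‖ ≤ 1 ∧ t = ‖T x‖}.Nonempty) h
  exact ⟨x, hx, hlt⟩

/-- Up to an arbitrarily small `δ`, the radius `e_k(T)` is attained, and the covering scales to
balls of any radius `t`. -/
theorem IsBoundedOp.exists_cover [RBanachSpace 𝕜 r X] [RBanachSpace 𝕜 r Y]
    (hT : IsBoundedOp T) (k : ℕ) {δ : ℝ} (hδ : 0 < δ) {t : ℝ} (ht : 0 < t) :
    ∃ S : Finset Y, S.card ≤ 2 ^ (k - 1) ∧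
      ∀ x : X, ‖x‖ ≤ t → ∃ c ∈ S, ‖T x - c‖ ≤ t * (entropyNumber k T + δ) := by
  classical
  obtain ⟨C, hC0, hC⟩ := hT.exists_bound (RBanachSpace.norm_nonneg 𝕜 r)
  obtain ⟨ε, ⟨-, c, hc⟩, hε⟩ := exists_lt_of_csInf_lt
    (s := {ε : ℝ | 0 < ε ∧ ∃ c : Fin (2 ^ (k - 1)) → Y,
      ∀ y ∈ T '' {x : X | ‖x‖ ≤ 1}, ∃ j, ‖y - c j‖ ≤ ε})
    ⟨C, hC0, fun _ => 0, by
      rintro _ ⟨x, hx, rfl⟩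
      exact ⟨⟨0, by positivity⟩, by simpa using hC x hx⟩⟩
    (lt_add_of_pos_right (entropyNumber k T) hδ)
  refine ⟨Finset.univ.image fun j => ((t : ℝ) : 𝕜) • c j,
    Finset.card_image_le.trans (by simp), fun x hx => ?_⟩
  obtain ⟨j, hj⟩ := hc (T (((t⁻¹ : ℝ) : 𝕜) • x)) ⟨_, by
    change ‖_‖ ≤ (1 : ℝ)
    rw [RBanachSpace.norm_real_smul 𝕜 r (by positivity), inv_mul_le_iff₀ ht, mul_one]
    exact hx, rfl⟩
  refine ⟨_, Finset.mem_image_of_mem _ (Finset.mem_univ j), ?_⟩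
  have e : T x - ((t : ℝ) : 𝕜) • c j
      = ((t : ℝ) : 𝕜) • (T (((t⁻¹ : ℝ) : 𝕜) • x) - c j) := by
    rw [smul_sub, map_smul, smul_smul, ← RCLike.ofReal_mul, mul_inv_cancel₀ ht.ne',
      RCLike.ofReal_one, one_smul]
  rw [e, RBanachSpace.norm_real_smul 𝕜 r ht.le]
  gcongr
  exact hj.trans hε.le

/-- Below the entropy number there are large separated families: a maximal one would otherwise be
a covering by few balls. -/
theorem exists_separated [RBanachSpace 𝕜 r Y] {k : ℕ} {ε : ℝ} (hε : 0 < ε)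
    (h : ε < entropyNumber k T) :
    ∃ S : Finset X, S.card = 2 ^ (k - 1) ∧ (∀ x ∈ S, ‖x‖ ≤ 1) ∧
      ∀ x ∈ S, ∀ y ∈ S, x ≠ y → ε ≤ ‖T x - T y‖ := by
  classical
  suffices ∀ N ≤ 2 ^ (k - 1), ∃ S : Finset X, S.card = N ∧ (∀ x ∈ S, ‖x‖ ≤ 1) ∧
      ∀ x ∈ S, ∀ y ∈ S, x ≠ y → ε ≤ ‖T x - T y‖ from this _ le_rfl
  intro N
  induction N with
  | zero => exact fun _ => ⟨∅, by simp⟩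
  | succ N ih =>
    intro hN
    obtain ⟨S, hS, hS1, hS2⟩ := ih (by omega)
    have : ∃ x : X, ‖x‖ ≤ 1 ∧ ∀ y ∈ S, ε < ‖T x - T y‖ := by
      by_contra! hcon
      refine h.not_ge (setEntropyNumber_le hε (S.image T)
        (Finset.card_image_le.trans (by omega)) ?_)
      rintro _ ⟨x, hx, rfl⟩
      obtain ⟨y, hy, hxy⟩ := hcon x hx
      exact ⟨_, Finset.mem_image_of_mem _ hy, hxy⟩
    obtain ⟨x, hx, hxS⟩ := this
    have hmem : x ∉ S := fun hm => by
      have := hxS x hm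
      rw [sub_self, RBanachSpace.norm_zero 𝕜 r] at this
      linarith
    refine ⟨insert x S, by rw [Finset.card_insert_of_notMem hmem, hS], ?_, ?_⟩
    · simpa [hx] using hS1
    · intro a ha b hb hab
      rcases Finset.mem_insert.1 ha with rfl | ha'
      · exact (hxS b ((Finset.mem_insert.1 hb).resolve_left hab.symm)).le
      · rcases Finset.mem_insert.1 hb with rfl | hb'
        · rw [← RBanachSpace.norm_neg 𝕜 r, neg_sub]
          exact (hxS a ha').le
        · exact hS2 a ha' b hb' hab

end Bounded

end Operators

/-! ### The quasi-norm of `l_p^m(X_i)` -/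

section PiLp

variable {m : ℕ} {X : Fin m → Type u} [∀ i, Norm (X i)]

theorem expGap_pos {p q : ℝ≥0∞} (hp : 0 < p) (hpq : p < q) : 0 < expGap p q := by
  rw [expGap, sub_pos]
  refine (ENNReal.toReal_lt_toReal ?_ ?_).2 (ENNReal.inv_lt_inv.2 hpq)
  · simpa using (hp.trans hpq).ne'
  · simpa using hp.ne'

/-- If `‖y_i‖ ≤ C v_i ^ (1 / q)` for weights of total mass at most `V`, then
`‖y‖ ≤ C V ^ (1 / q)`; the case `q = ∞` is included. -/
theorem PiLp.norm_le_of_weights (hX : ∀ i (x : X i), 0 ≤ ‖x‖) {q : ℝ≥0∞} (hq : 0 < q)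
    (y : PiLp q X) {C V : ℝ} (hC : 0 ≤ C) (v : Fin m → ℝ) (hv : ∀ i, 0 ≤ v i)
    (hV : ∑ i, v i ≤ V) (h : ∀ i, ‖y i‖ ≤ C * v i ^ (q⁻¹).toReal) :
    ‖y‖ ≤ C * V ^ (q⁻¹).toReal := by
  rcases eq_or_ne q ⊤ with rfl | hq'
  · rw [PiLp.norm_eq_ciSup]
    simp only [ENNReal.inv_top, ENNReal.toReal_zero, Real.rpow_zero, mul_one] at h ⊢
    exact Real.iSup_le h hC
  · have hQ : 0 < q.toReal := ENNReal.toReal_pos hq.ne' hq'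
    have hV0 : 0 ≤ V := (Finset.sum_nonneg fun i _ => hv i).trans hV
    have hQ' : q.toReal⁻¹ * q.toReal = 1 := inv_mul_cancel₀ hQ.ne'
    rw [PiLp.norm_eq_sum hQ, ENNReal.toReal_inv, one_div,
      Real.rpow_inv_le_iff_of_pos (Finset.sum_nonneg fun i _ => Real.rpow_nonneg (hX i _) _)
        (by positivity) hQ, Real.mul_rpow hC (by positivity), ← Real.rpow_mul hV0, hQ',
      Real.rpow_one]
    refine le_trans (Finset.sum_le_sum fun i _ => ?_)
      ((Finset.mul_sum _ _ _).symm.trans_le (mul_le_mul_of_nonneg_left hV (by positivity)))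
    have := Real.rpow_le_rpow (hX i _) (h i) hQ.le
    rwa [ENNReal.toReal_inv, Real.mul_rpow hC (Real.rpow_nonneg (hv i) _),
      ← Real.rpow_mul (hv i), hQ', Real.rpow_one] at this

theorem PiLp.card_rpow_mul_le_norm (hX : ∀ i (x : X i), 0 ≤ ‖x‖) {q : ℝ≥0∞} (hq : 0 < q)
    (y : PiLp q X) {δ : ℝ} (hδ : 0 ≤ δ) {I : Finset (Fin m)} (hI : I.Nonempty)
    (h : ∀ i ∈ I, δ ≤ ‖y i‖) : (I.card : ℝ) ^ (q⁻¹).toReal * δ ≤ ‖y‖ := by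
  rcases eq_or_ne q ⊤ with rfl | hq'
  · obtain ⟨i, hi⟩ := hI
    rw [PiLp.norm_eq_ciSup]
    simpa using (h i hi).trans (le_ciSup (f := fun i => ‖y i‖) (Set.finite_range _).bddAbove i)
  · have hQ : 0 < q.toReal := ENNReal.toReal_pos hq.ne' hq'
    have hQ' : q.toReal⁻¹ * q.toReal = 1 := inv_mul_cancel₀ hQ.ne'
    rw [PiLp.norm_eq_sum hQ, ENNReal.toReal_inv, one_div,
      Real.le_rpow_inv_iff_of_pos (by positivity)
        (Finset.sum_nonneg fun i _ => Real.rpow_nonneg (hX i _) _) hQ,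
      Real.mul_rpow (by positivity) hδ, ← Real.rpow_mul (by positivity), hQ', Real.rpow_one,
      ← nsmul_eq_mul]
    exact (Finset.card_nsmul_le_sum _ _ _ fun i hi => Real.rpow_le_rpow hδ (h i hi) hQ.le).trans
      (Finset.sum_le_sum_of_subset_of_nonneg (Finset.subset_univ _)
        fun i _ _ => Real.rpow_nonneg (hX i _) _)

theorem PiLp.norm_le_one_iff (hX : ∀ i (x : X i), 0 ≤ ‖x‖) {p : ℝ≥0∞} (hp : 0 < p.toReal)
    (x : PiLp p X) : ‖x‖ ≤ 1 ↔ ∑ i, ‖x i‖ ^ p.toReal ≤ 1 := by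
  rw [PiLp.norm_eq_sum hp, one_div, Real.rpow_inv_le_iff_of_pos
    (Finset.sum_nonneg fun i _ => Real.rpow_nonneg (hX i _) _) zero_le_one hp, Real.one_rpow]

end PiLp

/-! ### Words, Hamming distance and the lower bound -/

section Words

variable {A : Type*} [Fintype A] [DecidableEq A] {l : ℕ}

/-- A Hamming ball of radius `l / 2` around `w₀` has at most `(2 √|A|) ^ l` elements, since giving
a word at distance `d` from `w₀` the weight `|A| ^ (-d)` makes the total weight of all words at
most `2 ^ l`. -/
theorem card_sq_le_of_hammingDist_le (W : Finset (Fin l → A)) (w₀ : Fin l → A)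
    (hW : ∀ w ∈ W, 2 * hammingDist w w₀ ≤ l) : W.card ^ 2 ≤ (4 * Fintype.card A) ^ l := by
  rcases Nat.eq_zero_or_pos (Fintype.card A) with hA | hA
  · have := Fintype.card_eq_zero_iff.1 hA
    rcases Nat.eq_zero_or_pos l with rfl | hl
    · have := Finset.card_le_one_of_subsingleton W
      simpa using this
    · exact isEmptyElim (w₀ ⟨0, hl⟩)
  set g : ℝ := √(Fintype.card A) with hg
  have hA' : (1 : ℝ) ≤ Fintype.card A := by exact_mod_cast hA
  have hgg : g ^ 2 = Fintype.card A := Real.sq_sqrt (by positivity)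
  have hg1 : 1 ≤ g := Real.one_le_sqrt.2 hA'
  have hg0 : 0 < g := by positivity
  have hwt : ∀ w : Fin l → A, ∏ a, (if w a = w₀ a then (1 : ℝ) else (g ^ 2)⁻¹)
      = (g ^ (2 * hammingDist w w₀))⁻¹ := fun w => by
    rw [Finset.prod_ite, Finset.prod_const_one, Finset.prod_const, one_mul, pow_mul, inv_pow]
    rfl
  have hsum : ∑ w : Fin l → A, ∏ a, (if w a = w₀ a then (1 : ℝ) else (g ^ 2)⁻¹) ≤ 2 ^ l := by
    have := Finset.prod_univ_sum (fun _ : Fin l => (Finset.univ : Finset A))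
      (fun a c => if c = w₀ a then (1 : ℝ) else (g ^ 2)⁻¹)
    rw [Fintype.piFinset_univ] at this
    rw [← this]
    refine (Finset.prod_le_prod (fun a _ => Finset.sum_nonneg fun c _ => by positivity)
      (g := fun _ => 2) fun a _ => ?_).trans (by simp)
    calc ∑ c, (if c = w₀ a then (1 : ℝ) else (g ^ 2)⁻¹)
        ≤ ∑ c, ((if c = w₀ a then (1 : ℝ) else 0) + (g ^ 2)⁻¹) :=
          Finset.sum_le_sum fun c _ => by split_ifs <;> simp [sq_nonneg]
      _ = 2 := by
          rw [Finset.sum_add_distrib, Finset.sum_ite_eq' Finset.univ, Finset.sum_const,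
            Finset.card_univ, nsmul_eq_mul, hgg, mul_inv_cancel₀ (by positivity)]
          norm_num
  have hcard : (W.card : ℝ) * (g ^ l)⁻¹ ≤ 2 ^ l := by
    rw [← nsmul_eq_mul]
    refine (Finset.card_nsmul_le_sum W _ _ fun w hw => ?_).trans
      ((Finset.sum_le_sum_of_subset_of_nonneg (Finset.subset_univ W)
        fun w _ _ => Finset.prod_nonneg fun a _ => by positivity).trans hsum)
    rw [hwt]
    gcongr
    exact hW w hw
  have h : (W.card : ℝ) ≤ (2 * g) ^ l := by
    rwa [← div_eq_mul_inv, div_le_iff₀ (by positivity), ← mul_pow] at hcard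
  have h2 : (W.card : ℝ) ^ 2 ≤ (4 * Fintype.card A : ℝ) ^ l := by
    calc (W.card : ℝ) ^ 2 ≤ ((2 * g) ^ l) ^ 2 := by gcongr
      _ = (4 * Fintype.card A : ℝ) ^ l := by
          rw [← pow_mul, mul_comm l, pow_mul, mul_pow, hgg]
          norm_num
  exact_mod_cast h2

/-- If `2 ^ n` classes cover all words of length `l`, and the alphabet is large, then two words
in a common class differ in more than half of their letters. -/
theorem exists_hammingDist_gt {n : ℕ} (φ : (Fin l → A) → Fin (2 ^ n))
    (h : 4 ^ (n + 1 + l) ≤ Fintype.card A ^ l) : ∃ w w', φ w = φ w' ∧ l < 2 * hammingDist w w' := by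
  by_contra! hcon
  set Q := Fintype.card A
  have hclass : ∀ j, (Finset.univ.filter fun w => φ w = j).card ^ 2 ≤ (4 * Q) ^ l := fun j => by
    rcases (Finset.univ.filter fun w => φ w = j).eq_empty_or_nonempty with he | ⟨w₀, hw₀⟩
    · simp [he]
    · refine card_sq_le_of_hammingDist_le _ w₀ fun w hw => hcon _ _ ?_
      rw [(Finset.mem_filter.1 hw).2, (Finset.mem_filter.1 hw₀).2]
  obtain ⟨j, -, hj⟩ := Finset.exists_le_card_fiber_of_nsmul_le_card_of_maps_to
    (s := (Finset.univ : Finset (Fin l → A))) (t := Finset.univ) (f := φ)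
    (b := (Q : ℝ) ^ l / 2 ^ n)
    (fun _ _ => Finset.mem_univ _) ⟨⟨0, by positivity⟩, Finset.mem_univ _⟩ (by
      rw [Finset.card_univ, Fintype.card_fin, nsmul_eq_mul, Finset.card_univ, Fintype.card_pi_const]
      push_cast
      rw [mul_div_cancel₀ _ (by positivity)])
  have h1 : ((Q : ℝ) ^ l / 2 ^ n) ^ 2 ≤ (4 * Q) ^ l :=
    (pow_le_pow_left₀ (by positivity) hj 2).trans (by exact_mod_cast hclass j)
  have h2 : (4 : ℝ) ^ (n + 1 + l) ≤ (Q : ℝ) ^ l := by exact_mod_cast h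
  have h0 : (0 : ℝ) < (Q : ℝ) ^ l := lt_of_lt_of_le (by positivity) h2
  rw [div_pow, ← pow_mul 2, mul_comm n, pow_mul 2, div_le_iff₀ (by positivity), mul_pow, sq] at h1
  norm_num at h1
  have h3 : (Q : ℝ) ^ l ≤ 4 ^ l * 4 ^ n := by nlinarith
  rw [← pow_add] at h3
  have : (4 : ℝ) ^ (l + n) < 4 ^ (n + 1 + l) := pow_lt_pow_right₀ (by norm_num) (by omega)
  linarith

end Words

section Packing

variable {𝕜 : Type w} [RCLike 𝕜] {r : ℝ} {m : ℕ} {X : Fin m → Type u} {Y : Fin m → Type v}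
  [∀ i, AddCommGroup (X i)] [∀ i, Module 𝕜 (X i)] [∀ i, Norm (X i)]
  [∀ i, AddCommGroup (Y i)] [∀ i, Module 𝕜 (Y i)] [∀ i, Norm (Y i)]
  [∀ i, RBanachSpace 𝕜 r (X i)] [∀ i, RBanachSpace 𝕜 r (Y i)]
  {T : ∀ i, X i →ₗ[𝕜] Y i} {p q : ℝ≥0∞}

theorem PiLp.coord_le_one {m : ℕ} {X : Fin m → Type u} [∀ i, Norm (X i)]
    (hX : ∀ i (x : X i), 0 ≤ ‖x‖) {p : ℝ≥0∞} (hp : 0 < p.toReal) {x : PiLp p X} (hx : ‖x‖ ≤ 1)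
    (i : Fin m) : ‖x i‖ ≤ 1 := by
  rw [PiLp.norm_le_one_iff hX hp] at hx
  have := (Finset.single_le_sum (fun i _ => Real.rpow_nonneg (hX i (x i)) p.toReal)
    (Finset.mem_univ i)).trans hx
  by_contra! hcon
  exact this.not_gt (Real.one_lt_rpow hcon hp)

variable (r)

include r

theorem exists_diagOp_bound (hp : 0 < p.toReal) (hq : 0 < q) (hT : ∀ i, IsBoundedOp (T i)) :
    ∃ C : ℝ, 0 < C ∧ ∀ x : PiLp p X, ‖x‖ ≤ 1 → ‖diagOp p q T x‖ ≤ C := by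
  choose C hC0 hC using fun i => (hT i).exists_bound (RBanachSpace.norm_nonneg 𝕜 r)
  have hS : 0 ≤ ∑ i, C i := Finset.sum_nonneg fun i _ => (hC0 i).le
  refine ⟨((∑ i, C i) * m ^ (q⁻¹).toReal) + 1, by positivity, fun x hx => ?_⟩
  refine (PiLp.norm_le_of_weights (fun i => RBanachSpace.norm_nonneg 𝕜 r) hq _ hS
    (V := m) (fun _ => 1) (by simp) (by simp) fun i => ?_).trans (by linarith)
  rw [Real.one_rpow, mul_one]
  exact (hC i _ (PiLp.coord_le_one (fun i => RBanachSpace.norm_nonneg 𝕜 r) hp hx i)).trans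
    (Finset.single_le_sum (fun i _ => (hC0 i).le) (Finset.mem_univ i))

/-- The coordinates are partitioned into `l` blocks by `b`, and every letter `a : A` gives a vector
`z · a` in the unit ball of each block, different letters being `ε`-separated by `T` in each block.
The words of length `l` then give vectors `l ^ (-1 / p) (z · w_b)` in the unit ball of `l_p^m(X_i)`;
since two words in one covering ball differ in more than `l / 2` letters, one of the two is far from
the centre in at least `l / 4` coordinates. -/
theorem le_entropyNumber_diagOp {n l : ℕ} (hp : 0 < p.toReal) (hq : 0 < q) (hr : 0 < r)
    (hn : 1 ≤ n) (hl : 0 < l) (hT : ∀ i, IsBoundedOp (T i)) {A : Type*} [Fintype A]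
    (b : Fin m → Fin l) (z : ∀ i, A → X i)
    (hz : ∀ j a, ∑ i with b i = j, ‖z i a‖ ^ p.toReal ≤ 1) {ε : ℝ} (hε : 0 < ε)
    (hsep : ∀ j a a', a ≠ a' → ∃ i, b i = j ∧ ε ≤ ‖T i (z i a) - T i (z i a')‖)
    (hA : 4 ^ (n + l) ≤ Fintype.card A ^ l) :
    2 ^ (-(1 / r)) * 4 ^ (-(q⁻¹).toReal) * (l : ℝ) ^ (-expGap p q) * ε
      ≤ entropyNumber n (diagOp p q T) := by
  classical
  have hX : ∀ i (x : X i), 0 ≤ ‖x‖ := fun i => RBanachSpace.norm_nonneg 𝕜 r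
  have hY : ∀ i (y : Y i), 0 ≤ ‖y‖ := fun i => RBanachSpace.norm_nonneg 𝕜 r
  obtain ⟨C, hC0, hC⟩ := exists_diagOp_bound (p := p) (q := q) r hp hq hT
  refine le_csInf ⟨C, hC0, fun _ => 0, ?_⟩ ?_
  · rintro _ ⟨x, hx, rfl⟩
    exact ⟨⟨0, by positivity⟩, by simpa using hC x hx⟩
  rintro ε' ⟨-, c, hc⟩
  have hl0 : (0 : ℝ) < l := by exact_mod_cast hl
  set t : ℝ := (l : ℝ) ^ (-(1 / p.toReal)) with ht
  have ht0 : 0 < t := by positivity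
  have htp : t ^ p.toReal = (l : ℝ)⁻¹ := by
    rw [ht, ← Real.rpow_mul hl0.le, neg_mul, one_div_mul_cancel hp.ne', Real.rpow_neg_one]
  let x : (Fin l → A) → PiLp p X := fun w => WithLp.toLp p fun i => (t : 𝕜) • z i (w (b i))
  have hx : ∀ w, ‖x w‖ ≤ 1 := fun w => by
    rw [PiLp.norm_le_one_iff hX hp]
    have : ∀ i, ‖x w i‖ ^ p.toReal = (l : ℝ)⁻¹ * ‖z i (w (b i))‖ ^ p.toReal := fun i => by
      change ‖(t : 𝕜) • z i (w (b i))‖ ^ p.toReal = _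
      rw [RBanachSpace.norm_real_smul 𝕜 r ht0.le, Real.mul_rpow ht0.le (hX _ _), htp]
    simp only [this]
    rw [← Finset.mul_sum, inv_mul_le_iff₀ hl0, mul_one,
      ← Finset.sum_fiberwise_of_maps_to (s := Finset.univ) (t := Finset.univ) (g := b) (by simp)]
    refine (Finset.sum_le_sum (g := fun _ => (1 : ℝ)) fun j _ => ?_).trans (by simp)
    refine (Finset.sum_congr rfl fun i hi => ?_).trans_le (hz j (w j))
    rw [(Finset.mem_filter.1 hi).2]
  choose φ hφ using fun w => hc _ ⟨x w, hx w, rfl⟩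
  obtain ⟨w, w', hww, hd⟩ := exists_hammingDist_gt φ
    (by rwa [Nat.sub_add_cancel hn])
  set D : Finset (Fin l) := Finset.univ.filter fun j => w j ≠ w' j with hD
  have hDc : l < 2 * D.card := hd
  obtain ⟨j₀, hj₀⟩ : D.Nonempty := Finset.card_pos.1 (by omega)
  obtain ⟨i₀, -⟩ := hsep j₀ (w j₀) (w' j₀) (Finset.mem_filter.1 hj₀).2
  have : Nonempty (Fin m) := ⟨i₀⟩
  -- one coordinate in each block on which the words differ
  choose! i hib hi using fun j (hj : j ∈ D) => hsep j (w j) (w' j) (Finset.mem_filter.1 hj).2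
  have hinj : Set.InjOn i D := fun j hj j' hj' he => by rw [← hib j hj, he, hib j' hj']
  set η : ℝ := 2 ^ (-(1 / r)) * (t * ε) with hη
  have hη0 : 0 < η := by positivity
  have hfar : ∀ j ∈ D, η ≤ ‖diagOp p q T (x w) (i j) - c (φ w) (i j)‖ ∨
      η ≤ ‖diagOp p q T (x w') (i j) - c (φ w) (i j)‖ := fun j hj => by
    refine RBanachSpace.exists_far_of_sub 𝕜 r hr (by positivity) ?_
    change _ ≤ ‖T (i j) ((t : 𝕜) • z (i j) (w (b (i j)))) -
      T (i j) ((t : 𝕜) • z (i j) (w' (b (i j))))‖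
    rw [hib j hj, map_smul, map_smul, ← smul_sub, RBanachSpace.norm_real_smul 𝕜 r ht0.le]
    exact mul_le_mul_of_nonneg_left (hi j hj) ht0.le
  have key : ∀ y : PiLp q Y, ‖y - c (φ w)‖ ≤ ε' → ∀ E ⊆ D, D.card ≤ 2 * E.card →
      (∀ j ∈ E, η ≤ ‖y (i j) - c (φ w) (i j)‖) →
      2 ^ (-(1 / r)) * 4 ^ (-(q⁻¹).toReal) * (l : ℝ) ^ (-expGap p q) * ε ≤ ε' := by
    intro y hy E hED hE hfarE
    have hcard : l < 4 * (E.image i).card := by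
      rw [Finset.card_image_of_injOn (hinj.mono (by exact_mod_cast hED))]
      omega
    have h1 := PiLp.card_rpow_mul_le_norm hY hq (y - c (φ w)) hη0.le (I := E.image i)
      (Finset.card_pos.1 (by omega)) (by
        intro k hk
        obtain ⟨j, hj, rfl⟩ := Finset.mem_image.1 hk
        exact hfarE j hj)
    refine le_trans ?_ (h1.trans hy)
    have h2 : (l / 4 : ℝ) ^ (q⁻¹).toReal ≤ ((E.image i).card : ℝ) ^ (q⁻¹).toReal := by
      refine Real.rpow_le_rpow (by positivity) ?_ ENNReal.toReal_nonneg
      have : (l : ℝ) < 4 * (E.image i).card := by exact_mod_cast hcard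
      linarith
    refine le_trans (le_of_eq ?_) (mul_le_mul_of_nonneg_right h2 hη0.le)
    rw [hη, ht, expGap, ENNReal.toReal_inv p, neg_sub, sub_eq_add_neg, Real.rpow_add hl0,
      Real.div_rpow hl0.le (by norm_num), Real.rpow_neg (by norm_num : (0 : ℝ) ≤ 4)]
    simp only [one_div]
    ring
  have hsplit : D.card ≤
      (D.filter fun j => η ≤ ‖diagOp p q T (x w) (i j) - c (φ w) (i j)‖).card +
      (D.filter fun j => η ≤ ‖diagOp p q T (x w') (i j) - c (φ w) (i j)‖).card := by
    refine le_trans (Finset.card_le_card fun j hj => ?_) (Finset.card_union_le _ _)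
    rcases hfar j hj with h | h
    · exact Finset.mem_union_left _ (Finset.mem_filter.2 ⟨hj, h⟩)
    · exact Finset.mem_union_right _ (Finset.mem_filter.2 ⟨hj, h⟩)
  rcases le_total (D.filter fun j => η ≤ ‖diagOp p q T (x w) (i j) - c (φ w) (i j)‖).card
    (D.filter fun j => η ≤ ‖diagOp p q T (x w') (i j) - c (φ w) (i j)‖).card with hle | hle
  · exact key _ (hww ▸ hφ w') _ (Finset.filter_subset _ _) (by omega)
      fun j hj => (Finset.mem_filter.1 hj).2
  · exact key _ (hφ w) _ (Finset.filter_subset _ _) (by omega)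
      fun j hj => (Finset.mem_filter.1 hj).2

end Packing

theorem rpow_mul_rpow_le_rpow_neg {l y α : ℝ} (hl : 0 < l) (hy : 0 < y) (hα : 0 ≤ α)
    (h : l * y ≤ 5) : 5 ^ (-α) * y ^ α ≤ l ^ (-α) := by
  rw [Real.rpow_neg (by norm_num), ← Real.inv_rpow (by norm_num), Real.rpow_neg hl.le,
    ← Real.inv_rpow hl.le, ← Real.mul_rpow (by norm_num) hy.le]
  refine Real.rpow_le_rpow (by positivity) ?_ hα
  rw [inv_mul_le_iff₀ (by norm_num), ← div_eq_mul_inv, le_div_iff₀ hl]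
  linarith

section Lower

variable {𝕜 : Type w} [RCLike 𝕜] (r : ℝ) {m : ℕ} {p q : ℝ≥0∞}

/-- The lower bound by `τ (log (2 s / n) / n) ^ α`, where `τ` is at most the norm of the first `s`
operators. With `t = log (2 s / n)`, about `2 n / (t + 1)` blocks of consecutive coordinates are
used. A letter selects a position in its block and one of `80` multiples of a norming vector there;
the multiples keep the alphabet large enough when the blocks are short. -/
theorem le_entropyNumber_diagOp_of_norm {X : Fin m → Type u} {Y : Fin m → Type v}
    [∀ i, AddCommGroup (X i)] [∀ i, Module 𝕜 (X i)] [∀ i, Norm (X i)]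
    [∀ i, AddCommGroup (Y i)] [∀ i, Module 𝕜 (Y i)] [∀ i, Norm (Y i)]
    [∀ i, RBanachSpace 𝕜 r (X i)] [∀ i, RBanachSpace 𝕜 r (Y i)] {T : ∀ i, X i →ₗ[𝕜] Y i}
    (hp : 0 < p.toReal) (hq : 0 < q) (hα : 0 ≤ expGap p q) (hr : 0 < r) {n s : ℕ} (hn : 1 ≤ n)
    (hns : n ≤ s) (hsm : s ≤ m) (hs : s ≤ 2 ^ n) (hT : ∀ i, IsBoundedOp (T i)) {τ : ℝ} (hτ : 0 < τ)
    (hTτ : ∀ i : Fin m, (i : ℕ) < s → ∃ x : X i, ‖x‖ ≤ 1 ∧ τ ≤ ‖T i x‖) :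
    2 ^ (-(1 / r)) * 4 ^ (-(q⁻¹).toReal) * (5 ^ (-expGap p q) *
        (Real.logb 2 (2 * (s : ℝ) / n) / n) ^ expGap p q) * (τ / 80)
      ≤ entropyNumber n (diagOp p q T) := by
  classical
  have hX : ∀ i (x : X i), 0 ≤ ‖x‖ := fun i => RBanachSpace.norm_nonneg 𝕜 r
  have hn0 : (1 : ℝ) ≤ n := by exact_mod_cast hn
  have hns' : (n : ℝ) ≤ s := by exact_mod_cast hns
  have hs0 : (0 : ℝ) < s := by linarith
  set t := Real.logb 2 (2 * (s : ℝ) / n) with ht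
  have h2t : (2 : ℝ) ^ t = 2 * s / n :=
    Real.rpow_logb (by norm_num) (by norm_num) (by positivity)
  have ht1 : 1 ≤ t := by
    rw [ht, Real.le_logb_iff_rpow_le (by norm_num) (by positivity), Real.rpow_one,
      le_div_iff₀ (by positivity)]
    linarith
  have htn : t ≤ n + 1 := by
    rw [ht, Real.logb_le_iff_le_rpow (by norm_num) (by positivity), div_le_iff₀ (by positivity),
      Real.rpow_add_one (by norm_num), Real.rpow_natCast]
    have : (s : ℝ) ≤ 2 ^ n := by exact_mod_cast hs
    nlinarith
  set l : ℕ := ⌈2 * (n : ℝ) / (t + 1)⌉₊ with hl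
  have hl1 : 2 * (n : ℝ) ≤ l * (t + 1) := by
    rw [← div_le_iff₀ (by positivity)]
    exact Nat.le_ceil _
  have hl2 : l * (t + 1) ≤ 5 * n := by
    have := (Nat.ceil_lt_add_one (by positivity : 0 ≤ 2 * (n : ℝ) / (t + 1))).le
    have h3 := mul_le_mul_of_nonneg_right this (by positivity : 0 ≤ t + 1)
    rw [add_mul, div_mul_cancel₀ _ (by positivity)] at h3
    linarith
  have hl0 : 0 < l := Nat.ceil_pos.2 (by positivity)
  have hl0' : (0 : ℝ) < l := by exact_mod_cast hl0
  have hln : l ≤ n := by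
    rw [hl, Nat.ceil_le, div_le_iff₀ (by positivity)]
    nlinarith
  set b : ℕ := s / l with hb
  have hb0 : 0 < b := Nat.div_pos (hln.trans hns) hl0
  have hbl : b * l ≤ s := Nat.div_mul_le_self s l
  have hsb : s ≤ 2 * (b * l) := by
    have h1 := Nat.div_add_mod s l
    have h2 := Nat.mod_lt s hl0
    rw [← hb] at h1
    nlinarith
  have hbt : 2 ^ t ≤ 10 * (b : ℝ) := by
    rw [h2t, div_le_iff₀ (by positivity)]
    have : (s : ℝ) ≤ 2 * (b * l) := by exact_mod_cast hsb
    have h3 : (l : ℝ) * 2 ≤ 5 * n := (mul_le_mul_of_nonneg_left (by linarith) hl0'.le).trans hl2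
    nlinarith [(Nat.cast_nonneg b : (0 : ℝ) ≤ b)]
  have hxex : ∀ i : Fin m, ∃ x : X i, ‖x‖ ≤ 1 ∧ ((i : ℕ) < s → τ ≤ ‖T i x‖) := fun i => by
    by_cases hi : (i : ℕ) < s
    · obtain ⟨x, hx, hxτ⟩ := hTτ i hi
      exact ⟨x, hx, fun _ => hxτ⟩
    · exact ⟨0, by rw [RBanachSpace.norm_zero 𝕜 r]; exact zero_le_one, fun h => absurd h hi⟩
  choose x hx1 hxτ using hxex
  let B : Fin m → Fin l := fun i => if h : (i : ℕ) / b < l then ⟨i / b, h⟩ else ⟨0, hl0⟩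
  let z : ∀ i, Fin b × Fin 80 → X i := fun i a =>
    if (i : ℕ) / b < l ∧ (i : ℕ) % b = a.1 then ((((a.2 : ℝ) + 1) / 80 : ℝ) : 𝕜) • x i else 0
  have hsmall : ∀ c : Fin 80, ((c : ℝ) + 1) / 80 ≤ 1 := fun c => by
    rw [div_le_one (by norm_num)]
    have : (c : ℝ) ≤ 79 := by exact_mod_cast Nat.le_of_lt_succ c.2
    linarith
  have hpack := le_entropyNumber_diagOp r (p := p) (q := q) (n := n) hp hq hr hn hl0 hT B z
    (ε := τ / 80) ?_ (by positivity) ?_ ?_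
  · refine le_trans ?_ hpack
    gcongr
    refine rpow_mul_rpow_le_rpow_neg hl0' (by positivity) hα ?_
    rw [← mul_div_assoc, div_le_iff₀ (by positivity)]
    nlinarith
  · intro j a
    -- only the coordinate at position `a.1` of the block contributes
    have : ∀ i ∈ Finset.univ.filter (fun i => B i = j),
        ‖z i a‖ ^ p.toReal ≤ if (i : ℕ) = b * j + a.1 then (1 : ℝ) else 0 := by
      intro i hi
      have hB := (Finset.mem_filter.1 hi).2
      simp only [z]
      split_ifs with h1 h2 h2
      · rw [RBanachSpace.norm_real_smul 𝕜 r (by positivity)]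
        refine Real.rpow_le_one (mul_nonneg (by positivity) (hX _ _)) ?_ hp.le
        exact mul_le_one₀ (hsmall _) (hX _ _) (hx1 i)
      · exfalso
        apply h2
        simp only [B, dif_pos h1.1] at hB
        rw [← h1.2, ← hB, Nat.div_add_mod]
      all_goals rw [RBanachSpace.norm_zero 𝕜 r, Real.zero_rpow hp.ne']
      norm_num
    refine (Finset.sum_le_sum this).trans ?_
    rw [Finset.sum_ite, Finset.sum_const_zero, add_zero, Finset.sum_const, nsmul_eq_mul, mul_one]
    have : (Finset.filter (fun i : Fin m => (i : ℕ) = b * j + a.1)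
        (Finset.univ.filter fun i => B i = j)).card ≤ 1 :=
      Finset.card_le_one.2 fun i hi i' hi' => Fin.ext
        ((Finset.mem_filter.1 hi).2.trans (Finset.mem_filter.1 hi').2.symm)
    exact_mod_cast this
  · -- a letter with position `c` does not vanish at the coordinate `b * j + c` of the block `j`
    have hcoord : ∀ (j : Fin l) (c : Fin b), ∃ i : Fin m, (i : ℕ) < s ∧ B i = j ∧
        ∀ a, z i a = if c = a.1 then ((((a.2 : ℝ) + 1) / 80 : ℝ) : 𝕜) • x i else 0 := by
      intro j c
      have hlt : b * j + c < s := by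
        have := j.2
        have := c.2
        have : b * (j + 1) ≤ b * l := Nat.mul_le_mul_left _ (by omega)
        rw [mul_add, mul_one] at this
        omega
      have hdiv : (b * j + c : ℕ) / b = j := by
        rw [Nat.mul_add_div hb0, Nat.div_eq_of_lt c.2, add_zero]
      have hmod : (b * j + c : ℕ) % b = c := by
        rw [Nat.mul_add_mod, Nat.mod_eq_of_lt c.2]
      refine ⟨⟨b * j + c, by omega⟩, hlt, ?_, fun a => ?_⟩
      · simp only [B, hdiv, j.2, dif_pos]
      · simp only [z, hdiv, hmod, j.2, true_and, Fin.ext_iff]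
    intro j a a' haa
    have key : ∀ a a' : Fin b × Fin 80, a ≠ a' → ∀ i : Fin m, (i : ℕ) < s →
        (∀ a'', z i a'' = if a.1 = a''.1 then ((((a''.2 : ℝ) + 1) / 80 : ℝ) : 𝕜) • x i else 0) →
        τ / 80 ≤ ‖T i (z i a) - T i (z i a')‖ := by
      intro a a' haa i his hz
      have hsc : ∃ ρ : ℝ, 1 / 80 ≤ |ρ| ∧ z i a - z i a' = ((ρ : ℝ) : 𝕜) • x i := by
        rw [hz, hz, if_pos rfl]
        split_ifs with h
        · have hne : (a.2 : ℕ) ≠ a'.2 := fun h' => haa (Prod.ext h (Fin.ext h'))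
          refine ⟨((a.2 : ℝ) + 1) / 80 - ((a'.2 : ℝ) + 1) / 80, ?_, ?_⟩
          · have h1 : (1 : ℤ) ≤ |((a.2 : ℕ) : ℤ) - ((a'.2 : ℕ) : ℤ)| :=
              Int.one_le_abs (by omega)
            have h2 : (1 : ℝ) ≤ |(a.2 : ℝ) - (a'.2 : ℝ)| := by exact_mod_cast h1
            rw [show ((a.2 : ℝ) + 1) / 80 - ((a'.2 : ℝ) + 1) / 80
              = ((a.2 : ℝ) - (a'.2 : ℝ)) / 80 by ring, abs_div,
              abs_of_pos (by norm_num : (0 : ℝ) < 80)]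
            gcongr
          · rw [← sub_smul, RCLike.ofReal_sub]
        · refine ⟨((a.2 : ℝ) + 1) / 80, ?_, by rw [sub_zero]⟩
          rw [abs_of_nonneg (by positivity)]
          gcongr
          simp
      obtain ⟨ρ, hρ, he⟩ := hsc
      rw [← map_sub, he, map_smul, RBanachSpace.norm_smul r, RCLike.norm_ofReal]
      have := mul_le_mul hρ (hxτ i his) hτ.le (abs_nonneg ρ)
      linarith
    obtain ⟨i, his, hBi, hz⟩ := hcoord j a.1
    exact ⟨i, hBi, key a a' haa i his hz⟩
  · rw [Fintype.card_prod, Fintype.card_fin, Fintype.card_fin]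
    have h1 : (4 : ℝ) * 2 ^ (t + 1) ≤ b * 80 := by
      rw [Real.rpow_add_one (by norm_num)]
      linarith
    have h2 : (4 : ℝ) ^ n ≤ (2 ^ (t + 1)) ^ l := by
      rw [← Real.rpow_natCast (2 ^ (t + 1)), ← Real.rpow_mul (by norm_num),
        show (4 : ℝ) = 2 ^ (2 : ℝ) by norm_num, ← Real.rpow_natCast, ← Real.rpow_mul (by norm_num)]
      exact Real.rpow_le_rpow_of_exponent_le (by norm_num) (by linarith)
    have h3 : (4 : ℝ) ^ (n + l) ≤ (b * 80 : ℝ) ^ l := by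
      calc (4 : ℝ) ^ (n + l) = 4 ^ n * 4 ^ l := pow_add _ _ _
        _ ≤ (2 ^ (t + 1)) ^ l * 4 ^ l := by gcongr
        _ = (4 * 2 ^ (t + 1)) ^ l := by rw [← mul_pow, mul_comm]
        _ ≤ _ := by gcongr
    exact_mod_cast h3

/-- The lower bound by `(k / n) ^ α e_k(T₀)`: a letter is an element of a separated family of
`2 ^ (k - 1)` points, and every block is a single coordinate, about `4 n / k` of them. -/
theorem le_entropyNumber_diagOp_const {X : Type u} {Y : Type v}
    [AddCommGroup X] [Module 𝕜 X] [Norm X] [AddCommGroup Y] [Module 𝕜 Y] [Norm Y]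
    [RBanachSpace 𝕜 r X] [RBanachSpace 𝕜 r Y] {T₀ : X →ₗ[𝕜] Y}
    (hp : 0 < p.toReal) (hq : 0 < q) (hα : 0 ≤ expGap p q) (hr : 0 < r) {n k : ℕ} (hn : 1 ≤ n)
    (hm : 1 ≤ m) (hmn : m ≤ n) (hkn : k ≤ n) (hk : 16 * (n : ℝ) / m ≤ k) (hT : IsBoundedOp T₀)
    {ε : ℝ} (hε : 0 < ε) (hεk : ε < entropyNumber k T₀) :
    2 ^ (-(1 / r)) * 4 ^ (-(q⁻¹).toReal) * (5 ^ (-expGap p q) * ((k : ℝ) / n) ^ expGap p q) * ε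
      ≤ entropyNumber n (diagOp p q fun _ : Fin m => T₀) := by
  classical
  have hn0 : (1 : ℝ) ≤ n := by exact_mod_cast hn
  have hm0 : (1 : ℝ) ≤ m := by exact_mod_cast hm
  have hmn' : (m : ℝ) ≤ n := by exact_mod_cast hmn
  have hkn' : (k : ℝ) ≤ n := by exact_mod_cast hkn
  rw [div_le_iff₀ (by positivity)] at hk
  have hk16 : (16 : ℝ) ≤ k := by nlinarith
  have hk16' : 16 ≤ k := by exact_mod_cast hk16
  set l : ℕ := ⌈4 * (n : ℝ) / k⌉₊ with hl
  have hl0 : 0 < l := Nat.ceil_pos.2 (by positivity)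
  have hl0' : (0 : ℝ) < l := by exact_mod_cast hl0
  have hl1 : 4 * n ≤ l * k := by
    have : 4 * (n : ℝ) ≤ l * k := by
      rw [← div_le_iff₀ (by positivity)]
      exact Nat.le_ceil _
    exact_mod_cast this
  have hl2 : l * (k : ℝ) ≤ 5 * n := by
    have := (Nat.ceil_lt_add_one (by positivity : 0 ≤ 4 * (n : ℝ) / k)).le
    have h3 := mul_le_mul_of_nonneg_right this (by positivity : (0 : ℝ) ≤ k)
    rw [add_mul, div_mul_cancel₀ _ (by positivity)] at h3
    linarith
  have hlm : l ≤ m := by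
    rw [hl, Nat.ceil_le, div_le_iff₀ (by positivity)]
    nlinarith
  obtain ⟨S, hSc, hS1, hSε⟩ := exists_separated r hε hεk
  let B : Fin m → Fin l := fun i => if h : (i : ℕ) < l then ⟨i, h⟩ else ⟨0, hl0⟩
  let z : Fin m → S → X := fun i a => if (i : ℕ) < l then a.1 else 0
  have hpack := le_entropyNumber_diagOp r (p := p) (q := q) (n := n) hp hq hr hn hl0
    (fun _ => hT) B z ?_ hε ?_ ?_
  · refine le_trans ?_ hpack
    gcongr
    refine rpow_mul_rpow_le_rpow_neg hl0' (by positivity) hα ?_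
    rwa [← mul_div_assoc, div_le_iff₀ (by positivity)]
  · intro j a
    have : ∀ i ∈ Finset.univ.filter (fun i => B i = j),
        ‖z i a‖ ^ p.toReal ≤ if (i : ℕ) = j then (1 : ℝ) else 0 := by
      intro i hi
      have hB := (Finset.mem_filter.1 hi).2
      simp only [z]
      split_ifs with h1 h2 h2
      · exact Real.rpow_le_one (RBanachSpace.norm_nonneg 𝕜 r _) (hS1 _ a.2) hp.le
      · exfalso
        simp only [B, dif_pos h1] at hB
        exact h2 (by rw [← hB])
      all_goals rw [RBanachSpace.norm_zero 𝕜 r, Real.zero_rpow hp.ne']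
      norm_num
    refine (Finset.sum_le_sum this).trans ?_
    rw [Finset.sum_ite, Finset.sum_const_zero, add_zero, Finset.sum_const, nsmul_eq_mul, mul_one]
    have : (Finset.filter (fun i : Fin m => (i : ℕ) = j)
        (Finset.univ.filter fun i => B i = j)).card ≤ 1 :=
      Finset.card_le_one.2 fun i hi i' hi' => Fin.ext
        ((Finset.mem_filter.1 hi).2.trans (Finset.mem_filter.1 hi').2.symm)
    exact_mod_cast this
  · intro j a a' haa
    refine ⟨⟨j, j.2.trans_le hlm⟩, by simp [B], ?_⟩
    simp only [z, j.2, if_true]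
    exact hSε _ a.2 _ a'.2 fun h => haa (Subtype.ext h)
  · have h4 : 2 * (n + l) ≤ (k - 1) * l := by
      obtain ⟨d, hd⟩ := Nat.exists_eq_add_of_le' hk16'
      have h5 : k - 1 = d + 15 := by omega
      rw [hd] at hl1
      rw [h5]
      have := Nat.zero_le (l * d)
      linarith
    calc 4 ^ (n + l) = 2 ^ (2 * (n + l)) := by rw [pow_mul]; norm_num
      _ ≤ 2 ^ ((k - 1) * l) := Nat.pow_le_pow_right (by norm_num) h4
      _ = _ := by rw [Fintype.card_coe, hSc, pow_mul]

end Lower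

/-! ### Coverings with variable precision and the upper bound -/

/-- The precision (in bits) spent on a coordinate of mass `t = ‖x_i‖ ^ p`: it is proportional to
the mass, and it is replaced by `0` when it falls below the threshold `κ`. -/
noncomputable def level (n κ : ℕ) (t : ℝ) : ℕ :=
  if κ ≤ ⌊(n : ℝ) * t / 16⌋₊ then ⌊(n : ℝ) * t / 16⌋₊ else 0

theorem level_le {n κ : ℕ} {t : ℝ} (ht : 0 ≤ t) : (level n κ t : ℝ) ≤ n * t / 16 := by
  unfold level
  split_ifs
  · exact Nat.floor_le (by positivity)
  · simpa using (by positivity : 0 ≤ (n : ℝ) * t / 16)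

theorem level_cases {n : ℕ} (hn : 1 ≤ n) (κ : ℕ) (t : ℝ) :
    (κ ≤ level n κ t ∧ t ≤ 16 * (((level n κ t : ℝ) + 1) / n)) ∨
      (level n κ t = 0 ∧ t ≤ 16 * ((κ : ℝ) / n)) := by
  have hn0 : (0 : ℝ) < n := by exact_mod_cast hn
  have h := Nat.lt_floor_add_one ((n : ℝ) * t / 16)
  unfold level
  split_ifs with hκ
  · refine Or.inl ⟨hκ, ?_⟩
    rw [← mul_div_assoc, le_div_iff₀ hn0]
    linarith
  · refine Or.inr ⟨rfl, ?_⟩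
    have : ((⌊(n : ℝ) * t / 16⌋₊ : ℝ)) + 1 ≤ κ := by exact_mod_cast not_le.1 hκ
    rw [← mul_div_assoc, le_div_iff₀ hn0]
    linarith

/-- The admissible precision vectors: each entry is `0` or at least its threshold, and the total is
at most `n / 16`. -/
def levelVectors (n : ℕ) {m : ℕ} (κ : Fin m → ℕ) : Finset (Fin m → ℕ) :=
  (Fintype.piFinset fun i => insert 0 (Finset.Ico (κ i) (n + 1))).filter
    fun f => 16 * ∑ i, f i ≤ n

theorem level_mem_levelVectors {n m : ℕ} (κ : Fin m → ℕ) {t : Fin m → ℝ} (ht : ∀ i, 0 ≤ t i)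
    (hsum : ∑ i, t i ≤ 1) : (fun i => level n (κ i) (t i)) ∈ levelVectors n κ := by
  have h : 16 * ∑ i, level n (κ i) (t i) ≤ n := by
    have h1 : ∑ i, (level n (κ i) (t i) : ℝ) ≤ ∑ i, n / 16 * t i :=
      Finset.sum_le_sum fun i _ => (level_le (ht i)).trans_eq (by ring)
    rw [← Finset.mul_sum] at h1
    have h2 : (n : ℝ) / 16 * ∑ i, t i ≤ n / 16 := mul_le_of_le_one_right (by positivity) hsum
    have h3 : 16 * ∑ i, (level n (κ i) (t i) : ℝ) ≤ n := by linarith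
    exact_mod_cast h3
  refine Finset.mem_filter.2 ⟨Fintype.mem_piFinset.2 fun i => ?_, h⟩
  have hle : level n (κ i) (t i) ≤ n := by
    have := Finset.single_le_sum (f := fun i => level n (κ i) (t i)) (fun _ _ => Nat.zero_le _)
      (Finset.mem_univ i)
    omega
  rw [Finset.mem_insert, Finset.mem_Ico]
  by_cases h0 : level n (κ i) (t i) = 0
  · exact Or.inl h0
  · refine Or.inr ⟨?_, by omega⟩
    unfold level at h0 ⊢
    split_ifs at h0 ⊢ with hκ
    · exact hκ
    · exact absurd rfl h0

/-- The number of product centres. Weighting a precision vector `f` by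
`2 ^ (n / 8 - 2 * ∑ f_i) ≥ 1` factorizes the sum, with factors
`1 + ∑_{k ≥ κ_i} 2 ^ (-k) ≤ exp (2 * 2 ^ (-κ_i))`. -/
theorem sum_levelVectors_le {n m : ℕ} (hn : 1 ≤ n) (κ a : Fin m → ℕ) (N : Fin m → ℕ → ℕ)
    (hN : ∀ i k, N i k ≤ 2 ^ (a i + k)) (ha : 8 * ∑ i, a i ≤ n)
    (hκ : ∑ i, (1 / 2 : ℝ) ^ κ i ≤ n / 16) :
    ∑ f ∈ levelVectors n κ, ∏ i, N i (f i) ≤ 2 ^ (n - 1) := by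
  have hterm : ∀ f ∈ levelVectors n κ, ((∏ i, N i (f i) : ℕ) : ℝ)
      ≤ 2 ^ ((n : ℝ) / 4) * ∏ i, (1 / 2 : ℝ) ^ f i := by
    intro f hf
    have h16 : 16 * ∑ i, f i ≤ n := (Finset.mem_filter.1 hf).2
    have h1 : ∏ i, N i (f i) ≤ 2 ^ (∑ i, a i + ∑ i, f i) := by
      rw [← Finset.sum_add_distrib, ← Finset.prod_pow_eq_pow_sum]
      exact Finset.prod_le_prod' fun i _ => hN i (f i)
    have h2 : ((∏ i, N i (f i) : ℕ) : ℝ) ≤ 2 ^ (∑ i, a i + ∑ i, f i) := by exact_mod_cast h1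
    refine h2.trans ?_
    rw [Finset.prod_pow_eq_pow_sum, one_div, inv_pow, ← div_eq_mul_inv,
      le_div_iff₀ (by positivity), ← pow_add, ← Real.rpow_natCast]
    refine Real.rpow_le_rpow_of_exponent_le (by norm_num) ?_
    have h3 : (8 : ℝ) * (∑ i, a i : ℕ) ≤ n := by exact_mod_cast ha
    have h4 : (16 : ℝ) * (∑ i, f i : ℕ) ≤ n := by exact_mod_cast h16
    rw [Nat.cast_add, Nat.cast_add]
    linarith
  have hfac : ∀ i, ∑ k ∈ insert 0 (Finset.Ico (κ i) (n + 1)), (1 / 2 : ℝ) ^ k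
      ≤ Real.exp (2 * (1 / 2) ^ κ i) := by
    intro i
    have h1 : ∑ k ∈ insert 0 (Finset.Ico (κ i) (n + 1)), (1 / 2 : ℝ) ^ k
        ≤ 1 + ∑ k ∈ Finset.Ico (κ i) (n + 1), (1 / 2 : ℝ) ^ k := by
      by_cases h0 : 0 ∈ Finset.Ico (κ i) (n + 1)
      · rw [Finset.insert_eq_of_mem h0]
        linarith
      · rw [Finset.sum_insert h0, pow_zero]
    have h2 : ∑ k ∈ Finset.Ico (κ i) (n + 1), (1 / 2 : ℝ) ^ k ≤ (1 / 2) ^ κ i / (1 - 1 / 2) :=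
      geom_sum_Ico_le_of_lt_one (by norm_num) (by norm_num)
    have h3 := Real.add_one_le_exp (2 * (1 / 2 : ℝ) ^ κ i)
    have h4 : (1 / 2 : ℝ) ^ κ i / (1 - 1 / 2) = 2 * (1 / 2) ^ κ i := by ring
    linarith
  have htotal : ((∑ f ∈ levelVectors n κ, ∏ i, N i (f i) : ℕ) : ℝ) ≤ 2 ^ ((n : ℝ) / 2) := by
    rw [Nat.cast_sum]
    calc ∑ f ∈ levelVectors n κ, ((∏ i, N i (f i) : ℕ) : ℝ)
        ≤ ∑ f ∈ levelVectors n κ, 2 ^ ((n : ℝ) / 4) * ∏ i, (1 / 2 : ℝ) ^ f i :=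
          Finset.sum_le_sum hterm
      _ ≤ 2 ^ ((n : ℝ) / 4) * ∑ f ∈ Fintype.piFinset fun i => insert 0 (Finset.Ico (κ i) (n + 1)),
            ∏ i, (1 / 2 : ℝ) ^ f i := by
          rw [← Finset.mul_sum]
          gcongr
          exact Finset.filter_subset _ _
      _ = 2 ^ ((n : ℝ) / 4) * ∏ i, ∑ k ∈ insert 0 (Finset.Ico (κ i) (n + 1)), (1 / 2 : ℝ) ^ k := by
          rw [Finset.prod_univ_sum]
      _ ≤ 2 ^ ((n : ℝ) / 4) * ∏ i, Real.exp (2 * (1 / 2) ^ κ i) := by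
          gcongr with i
          exact hfac i
      _ ≤ 2 ^ ((n : ℝ) / 4) * 2 ^ ((n : ℝ) / 4) := by
          rw [← Real.exp_sum, ← Finset.mul_sum]
          gcongr
          calc Real.exp (2 * ∑ i, (1 / 2) ^ κ i) ≤ Real.exp (1 * ((n : ℝ) / 8)) := by
                apply Real.exp_le_exp.2; linarith
            _ = Real.exp 1 ^ ((n : ℝ) / 8) := Real.exp_mul _ _
            _ ≤ (2 ^ (2 : ℝ)) ^ ((n : ℝ) / 8) := by
                gcongr
                have := Real.exp_one_lt_d9
                norm_num
                linarith
            _ = 2 ^ ((n : ℝ) / 4) := by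
                rw [← Real.rpow_mul (by norm_num)]
                ring_nf
      _ = 2 ^ ((n : ℝ) / 2) := by
          rw [← Real.rpow_add (by norm_num)]
          ring_nf
  -- for `n = 1` the bound `√2` on an integer gives `1`
  rcases hn.eq_or_lt with rfl | hn2
  · have h2 : (2 : ℝ) ^ (((1 : ℕ) : ℝ) / 2) < 2 := by
      conv_rhs => rw [← Real.rpow_one 2]
      exact Real.rpow_lt_rpow_of_exponent_lt (by norm_num) (by norm_num)
    have h3 : ((∑ f ∈ levelVectors 1 κ, ∏ i, N i (f i) : ℕ) : ℝ) < (2 : ℕ) := by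
      exact_mod_cast htotal.trans_lt h2
    have h4 := Nat.cast_lt.1 h3
    rw [Nat.sub_self, pow_zero]
    omega
  · have h2 : (2 : ℝ) ^ ((n : ℝ) / 2) ≤ 2 ^ (n - 1) := by
      rw [← Real.rpow_natCast, Nat.cast_sub hn]
      refine Real.rpow_le_rpow_of_exponent_le (by norm_num) ?_
      have : (2 : ℝ) ≤ n := by exact_mod_cast hn2
      push_cast
      linarith
    exact_mod_cast htotal.trans h2

section Upper

variable {𝕜 : Type w} [RCLike 𝕜] (r : ℝ) {m : ℕ} {p q : ℝ≥0∞}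

/-- The upper bound from coverings `S i k` of the points of `T_i(B_{X_i})` whose level is `k`. -/
theorem entropyNumber_diagOp_le {X : Fin m → Type u} {Y : Fin m → Type v}
    [∀ i, AddCommGroup (X i)] [∀ i, Module 𝕜 (X i)] [∀ i, Norm (X i)]
    [∀ i, AddCommGroup (Y i)] [∀ i, Module 𝕜 (Y i)] [∀ i, Norm (Y i)]
    [∀ i, RBanachSpace 𝕜 r (X i)] [∀ i, RBanachSpace 𝕜 r (Y i)] {T : ∀ i, X i →ₗ[𝕜] Y i}
    (hp : 0 < p.toReal) (hq : 0 < q) {n : ℕ} (hn : 1 ≤ n) (κ a : Fin m → ℕ)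
    (ha : 8 * ∑ i, a i ≤ n) (hκ : ∑ i, (1 / 2 : ℝ) ^ κ i ≤ n / 16)
    (S : ∀ i, ℕ → Finset (Y i)) (hS : ∀ i k, (S i k).card ≤ 2 ^ (a i + k)) {C : ℝ} (hC : 0 < C)
    (d : Fin m → ℝ) (hd : ∀ i, 0 ≤ d i) (hd2 : ∑ i, d i ≤ 2)
    (hcov : ∀ i (x : X i), ‖x‖ ≤ 1 → ∃ c ∈ S i (level n (κ i) (‖x‖ ^ p.toReal)),
      ‖T i x - c‖ ≤ C * (‖x‖ ^ p.toReal + d i) ^ (q⁻¹).toReal) :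
    entropyNumber n (diagOp p q T) ≤ C * 3 ^ (q⁻¹).toReal := by
  classical
  have hX : ∀ i (x : X i), 0 ≤ ‖x‖ := fun i => RBanachSpace.norm_nonneg 𝕜 r
  have hY : ∀ i (y : Y i), 0 ≤ ‖y‖ := fun i => RBanachSpace.norm_nonneg 𝕜 r
  refine setEntropyNumber_le (by positivity)
    ((levelVectors n κ).biUnion fun f =>
      (Fintype.piFinset fun i => S i (f i)).image (WithLp.toLp q)) ?_ ?_
  · refine Finset.card_biUnion_le.trans (le_trans (Finset.sum_le_sum fun f _ => ?_)
      (sum_levelVectors_le hn κ a (fun i k => (S i k).card) hS ha hκ))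
    exact Finset.card_image_le.trans_eq (Fintype.card_piFinset _)
  · rintro _ ⟨x, hx, rfl⟩
    have hx1 := PiLp.coord_le_one hX hp hx
    have hxs := (PiLp.norm_le_one_iff hX hp x).1 hx
    have hw : ∀ i, 0 ≤ ‖x i‖ ^ p.toReal := fun i => Real.rpow_nonneg (hX i _) _
    choose c hcS hc using fun i => hcov i (x i) (hx1 i)
    refine ⟨WithLp.toLp q c, Finset.mem_biUnion.2 ⟨_, level_mem_levelVectors κ hw hxs,
      Finset.mem_image_of_mem _ (Fintype.mem_piFinset.2 hcS)⟩, ?_⟩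
    refine PiLp.norm_le_of_weights hY hq _ hC.le (fun i => ‖x i‖ ^ p.toReal + d i)
      (fun i => add_nonneg (hw i) (hd i)) ?_ hc
    rw [Finset.sum_add_distrib]
    linarith

/-- With `k` bits, the vectors of mass at most `64 k / n` are covered with the precision that the
`l_q`-norm allows for a coordinate of mass `k / n`. -/
theorem IsBoundedOp.exists_cover_level {X : Type u} {Y : Type v}
    [AddCommGroup X] [Module 𝕜 X] [Norm X] [AddCommGroup Y] [Module 𝕜 Y] [Norm Y]
    [RBanachSpace 𝕜 r X] [RBanachSpace 𝕜 r Y] {T : X →ₗ[𝕜] Y} (hT : IsBoundedOp T)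
    (hp : 0 < p.toReal) (hα : 0 ≤ expGap p q) {n k : ℕ} (hk : 1 ≤ k) (hkn : k ≤ n)
    {H δ : ℝ} (hδ : 0 < δ) (hH : ((k : ℝ) / n) ^ expGap p q * entropyNumber k T ≤ H) :
    ∃ S : Finset Y, S.card ≤ 2 ^ (k - 1) ∧ ∀ x : X, ‖x‖ ^ p.toReal ≤ 64 * ((k : ℝ) / n) →
      ∃ c ∈ S, ‖T x - c‖ ≤ 64 ^ (1 / p.toReal) * (H + δ) * ((k : ℝ) / n) ^ (q⁻¹).toReal := by
  have hk0 : (0 : ℝ) < k := by exact_mod_cast hk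
  have hkn' : (k : ℝ) ≤ n := by exact_mod_cast hkn
  have hn0 : (0 : ℝ) < n := hk0.trans_le hkn'
  set y : ℝ := (k : ℝ) / n with hy
  have hy0 : 0 < y := by positivity
  have hy1 : y ≤ 1 := (div_le_one hn0).2 hkn'
  obtain ⟨S, hS, hcov⟩ := hT.exists_cover r k hδ (t := (64 * y) ^ (p.toReal)⁻¹) (by positivity)
  refine ⟨S, hS, fun x hx => ?_⟩
  obtain ⟨c, hc, hxc⟩ := hcov x
    ((Real.le_rpow_inv_iff_of_pos (RBanachSpace.norm_nonneg 𝕜 r x) (by positivity) hp).2 hx)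
  refine ⟨c, hc, hxc.trans ?_⟩
  have hsplit : y ^ (p.toReal)⁻¹ = y ^ (q⁻¹).toReal * y ^ expGap p q := by
    rw [← Real.rpow_add hy0, expGap, ENNReal.toReal_inv p]
    ring_nf
  have hyα : y ^ expGap p q ≤ 1 := Real.rpow_le_one hy0.le hy1 hα
  rw [Real.mul_rpow (by norm_num) hy0.le, hsplit, one_div]
  calc 64 ^ (p.toReal)⁻¹ * (y ^ (q⁻¹).toReal * y ^ expGap p q) * (entropyNumber k T + δ)
      = 64 ^ (p.toReal)⁻¹ * y ^ (q⁻¹).toReal *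
        (y ^ expGap p q * entropyNumber k T + y ^ expGap p q * δ) := by ring
    _ ≤ 64 ^ (p.toReal)⁻¹ * y ^ (q⁻¹).toReal * (H + δ) := by
        gcongr
        exact mul_le_of_le_one_left hδ.le hyα
    _ = _ := by ring

end Upper

/-! ### Decreasing operator norms -/

/-- The threshold at the `i`-th coordinate (counted from `0`): about `2 log (i / n)` bits, which
makes `∑ 2 ^ (-κ_i)` a small multiple of `n`. -/
def threshold (n i : ℕ) : ℕ := 5 + 2 * Nat.clog 2 (i / n + 1)

theorem sum_inv_sq_div_le {n : ℕ} (hn : 1 ≤ n) {M : ℕ} (hM : 1 ≤ M) :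
    ∑ i ∈ Finset.range (n * M), (((i / n + 1 : ℕ) : ℝ) ^ 2)⁻¹ ≤ n * (2 - 1 / (M : ℝ)) := by
  have hblock : ∀ M : ℕ, ∑ i ∈ Finset.range n, ((((n * M + i) / n + 1 : ℕ) : ℝ) ^ 2)⁻¹
      = n * (((M + 1 : ℕ) : ℝ) ^ 2)⁻¹ := by
    intro M
    rw [Finset.sum_congr rfl (g := fun _ => (((M + 1 : ℕ) : ℝ) ^ 2)⁻¹) fun i hi => by
      rw [Nat.mul_add_div hn, Nat.div_eq_of_lt (Finset.mem_range.1 hi), add_zero]]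
    rw [Finset.sum_const, Finset.card_range, nsmul_eq_mul]
  induction M, hM using Nat.le_induction with
  | base =>
    have := hblock 0
    simp only [mul_zero, zero_add] at this
    rw [mul_one, this]
    norm_num
  | succ M hM ih =>
    rw [mul_add, mul_one, Finset.sum_range_add, hblock]
    refine (add_le_add_left ih _).trans ?_
    rw [← mul_add]
    gcongr
    have hM0 : (0 : ℝ) < M := by exact_mod_cast hM
    push_cast
    have : 1 / (M : ℝ) - 1 / (M + 1) - (((M : ℝ) + 1) ^ 2)⁻¹ = 1 / (M * (M + 1) ^ 2) := by
      field_simp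
      ring
    have h0 : 0 ≤ 1 / ((M : ℝ) * (M + 1) ^ 2) := by positivity
    linarith

theorem sum_threshold_le {n m : ℕ} (hn : 1 ≤ n) :
    ∑ i : Fin m, (1 / 2 : ℝ) ^ threshold n i ≤ n / 16 := by
  rcases Nat.eq_zero_or_pos m with rfl | hm
  · rw [Fin.sum_univ_zero]
    positivity
  have hterm : ∀ i : ℕ, (1 / 2 : ℝ) ^ threshold n i ≤ 1 / 32 * (((i / n + 1 : ℕ) : ℝ) ^ 2)⁻¹ := by
    intro i
    have h1 : (i / n + 1 : ℕ) ≤ 2 ^ Nat.clog 2 (i / n + 1) := Nat.le_pow_clog (by norm_num) _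
    have h2 : ((i / n + 1 : ℕ) : ℝ) ≤ 2 ^ Nat.clog 2 (i / n + 1) := by exact_mod_cast h1
    rw [threshold, pow_add, mul_comm 2, pow_mul, one_div, inv_pow 2 (Nat.clog _ _), inv_pow _ 2]
    norm_num only
    gcongr
  rw [Fin.sum_univ_eq_sum_range (fun i => (1 / 2 : ℝ) ^ threshold n i)]
  calc ∑ i ∈ Finset.range m, (1 / 2 : ℝ) ^ threshold n i
      ≤ ∑ i ∈ Finset.range (n * m), (1 / 2 : ℝ) ^ threshold n i :=
        Finset.sum_le_sum_of_subset_of_nonneg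
          (Finset.range_subset_range.2 (Nat.le_mul_of_pos_left m hn)) fun _ _ _ => by positivity
    _ ≤ ∑ i ∈ Finset.range (n * m), 1 / 32 * (((i / n + 1 : ℕ) : ℝ) ^ 2)⁻¹ :=
        Finset.sum_le_sum fun i _ => hterm i
    _ ≤ 1 / 32 * (n * (2 - 1 / (m : ℝ))) := by
        rw [← Finset.mul_sum]
        gcongr
        exact sum_inv_sq_div_le hn hm
    _ ≤ n / 16 := by
        have : 0 ≤ (n : ℝ) * (1 / m) := by positivity
        linarith

theorem threshold_le_logb {n i : ℕ} (hn : 1 ≤ n) (hi : n ≤ i + 1) :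
    (threshold n i : ℝ) ≤ 9 * Real.logb 2 (2 * ((i + 1 : ℕ) : ℝ) / n) := by
  have hn0 : (0 : ℝ) < n := by exact_mod_cast hn
  have hi' : (n : ℝ) ≤ (i + 1 : ℕ) := by exact_mod_cast hi
  have h1 : ((i / n + 1 : ℕ) : ℝ) ≤ 2 * ((i + 1 : ℕ) : ℝ) / n := by
    have h := Nat.cast_div_le (m := i) (n := n) (α := ℝ)
    rw [le_div_iff₀ hn0]
    rw [le_div_iff₀ hn0] at h
    push_cast at hi' ⊢
    linarith
  have h2 : Real.logb 2 ((i / n + 1 : ℕ) : ℝ) ≤ Real.logb 2 (2 * ((i + 1 : ℕ) : ℝ) / n) :=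
    Real.logb_le_logb_of_le (by norm_num) (by positivity) h1
  have h3 : 1 ≤ Real.logb 2 (2 * ((i + 1 : ℕ) : ℝ) / n) := by
    rw [Real.le_logb_iff_rpow_le (by norm_num) (by positivity), Real.rpow_one, le_div_iff₀ hn0]
    linarith
  have h4 : (Nat.clog 2 (i / n + 1) : ℝ) ≤ Real.logb 2 ((i / n + 1 : ℕ) : ℝ) + 1 := by
    have := Nat.ceil_lt_add_one (Real.logb_nonneg (b := 2) (x := ((i / n + 1 : ℕ) : ℝ))
      (by norm_num) (by push_cast; linarith [(Nat.cast_nonneg (i / n) : (0 : ℝ) ≤ (i / n : ℕ))]))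
    have h5 := Real.natCeil_logb_natCast 2 (i / n + 1)
    push_cast at h5 this ⊢
    rw [h5] at this
    exact this.le
  rw [threshold]
  push_cast at h2 h3 h4 ⊢
  linarith

section NormDecreasing

variable {𝕜 : Type w} [RCLike 𝕜] {m : ℕ} {X : Fin m → Type u} {Y : Fin m → Type v}
  [∀ i, AddCommGroup (X i)] [∀ i, Module 𝕜 (X i)] [∀ i, Norm (X i)]
  [∀ i, AddCommGroup (Y i)] [∀ i, Module 𝕜 (Y i)] [∀ i, Norm (Y i)] {T : ∀ i, X i →ₗ[𝕜] Y i}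

theorem le_quantityA (α : ℝ) {n : ℕ} {i : Fin m} (hi : n ≤ i + 1) (hin : (i : ℕ) + 1 ≤ 2 ^ n) :
    opQNorm (T i) * (Real.logb 2 (2 * ((i + 1 : ℕ) : ℝ) / n) / n) ^ α ≤ quantityA α n T := by
  refine le_csSup (Set.Finite.bddAbove ?_) ⟨_, i, rfl, hi, hin, rfl⟩
  refine (Set.finite_range fun i : Fin m =>
    opQNorm (T i) * (Real.logb 2 (2 * ((i + 1 : ℕ) : ℝ) / n) / n) ^ α).subset ?_
  rintro _ ⟨s, i, rfl, -, -, rfl⟩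
  exact ⟨i, rfl⟩

theorem le_quantityB (α : ℝ) {n k : ℕ} (hk : 1 ≤ k) (hkn : k ≤ n) (i : Fin m) :
    ((k : ℝ) / n) ^ α * entropyNumber k (T i) ≤ quantityB α n T := by
  refine le_csSup (Set.Finite.bddAbove ?_) ⟨k, i, hk, hkn, rfl⟩
  refine (Set.finite_range fun z : Fin (n + 1) × Fin m =>
    (((z.1 : ℕ) : ℝ) / n) ^ α * entropyNumber z.1 (T z.2)).subset ?_
  rintro _ ⟨k, i, -, hkn, rfl⟩
  exact ⟨(⟨k, by omega⟩, i), rfl⟩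

variable (r : ℝ) [∀ i, RBanachSpace 𝕜 r (X i)] [∀ i, RBanachSpace 𝕜 r (Y i)] {p q : ℝ≥0∞}

theorem quantityA_le (hp : 0 < p.toReal) (hq : 0 < q) (hα : 0 ≤ expGap p q) (hr : 0 < r) {n : ℕ}
    (hn : 1 ≤ n) (hT : ∀ i, IsBoundedOp (T i))
    (hmono : ∀ i j : Fin m, i ≤ j → opQNorm (T j) ≤ opQNorm (T i)) :
    2 ^ (-(1 / r)) * 4 ^ (-(q⁻¹).toReal) * 5 ^ (-expGap p q) / 80 * quantityA (expGap p q) n T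
      ≤ entropyNumber n (diagOp p q T) := by
  set c : ℝ := 2 ^ (-(1 / r)) * 4 ^ (-(q⁻¹).toReal) * 5 ^ (-expGap p q) / 80 with hc
  have hc0 : 0 < c := by positivity
  rw [← le_div_iff₀' hc0]
  refine Real.sSup_le ?_ (div_nonneg (entropyNumber_nonneg _ _) hc0.le)
  rintro _ ⟨s, i, rfl, hns, hs, rfl⟩
  rw [le_div_iff₀' hc0]
  set L : ℝ := (Real.logb 2 (2 * ((i + 1 : ℕ) : ℝ) / n) / n) ^ expGap p q with hL
  have hL0 : 0 ≤ L := by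
    have h1 : (n : ℝ) ≤ (i + 1 : ℕ) := by exact_mod_cast hns
    have h2 : (1 : ℝ) ≤ n := by exact_mod_cast hn
    refine Real.rpow_nonneg (div_nonneg (Real.logb_nonneg (by norm_num) ?_) (by positivity)) _
    rw [le_div_iff₀ (by positivity)]
    linarith
  have key : ∀ τ < opQNorm (T i), c * (τ * L) ≤ entropyNumber n (diagOp p q T) := by
    intro τ hτ
    rcases le_or_gt τ 0 with h0 | h0
    · exact (mul_nonpos_of_nonneg_of_nonpos hc0.le
        (mul_nonpos_of_nonpos_of_nonneg h0 hL0)).trans (entropyNumber_nonneg _ _)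
    · refine le_trans (le_of_eq ?_) (le_entropyNumber_diagOp_of_norm r hp hq hα hr hn hns i.2 hs hT
        h0 fun j hj => ?_)
      · rw [hc, hL]
        ring
      · obtain ⟨x, hx, hxτ⟩ := exists_lt_norm_apply r
          (hτ.trans_le (hmono j i (Fin.le_def.2 (by omega))))
        exact ⟨x, hx, hxτ.le⟩
  rcases hL0.eq_or_lt with h | h
  · rw [← h, mul_zero, mul_zero]
    exact entropyNumber_nonneg _ _
  · rw [← le_div_iff₀' hc0, ← le_div_iff₀ h]
    refine le_of_forall_lt_imp_le_of_dense fun τ hτ => ?_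
    rw [le_div_iff₀ h, le_div_iff₀' hc0]
    exact key τ hτ

include r in
theorem entropyNumber_diagOp_le_max (hp : 0 < p.toReal) (hq : 0 < q) (hα : 0 ≤ expGap p q)
    {n : ℕ} (hn : 1 ≤ n) (hnm : n ≤ m) (hm : m ≤ 2 ^ n) (hT : ∀ i, IsBoundedOp (T i))
    (hmono : ∀ i j : Fin m, i ≤ j → opQNorm (T j) ≤ opQNorm (T i))
    (h2 : opQNorm (T ⟨0, by omega⟩) ≤ 2 * opQNorm (T ⟨n - 1, by omega⟩)) :
    entropyNumber n (diagOp p q T) ≤ 2 * 144 ^ (1 / p.toReal) * 3 ^ (q⁻¹).toReal *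
      max (quantityA (expGap p q) n T) (quantityB (expGap p q) n T) := by
  classical
  have hn0 : (0 : ℝ) < n := by exact_mod_cast hn
  set P := p.toReal
  set β := (q⁻¹).toReal with hβ
  set α := expGap p q with hαdef
  have hαβ : α + β = P⁻¹ := by rw [hαdef, expGap, ENNReal.toReal_inv p, sub_add_cancel]
  have hβ0 : 0 ≤ β := ENNReal.toReal_nonneg
  set H := max (quantityA α n T) (quantityB α n T) with hH
  have hAH : quantityA α n T ≤ H := le_max_left _ _
  -- the error when a coordinate of mass below the threshold is approximated by `0`
  have hsmall : ∀ i : Fin m, opQNorm (T i) * (16 * ((threshold n i : ℝ) / n)) ^ α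
      ≤ 2 * 144 ^ (1 / P) * H := by
    intro i
    have hpow : (144 : ℝ) ^ α ≤ 144 ^ (1 / P) :=
      Real.rpow_le_rpow_of_exponent_le (by norm_num) (by rw [one_div]; linarith)
    have hTi := opQNorm_nonneg r (T := T i)
    rcases le_or_gt n (i + 1) with hi | hi
    · have hA := (le_quantityA (T := T) α hi (by omega)).trans hAH
      have ht := threshold_le_logb hn hi
      set t := Real.logb 2 (2 * ((i + 1 : ℕ) : ℝ) / n)
      have ht0 : 0 ≤ t := by
        have : (0 : ℝ) ≤ threshold n i := Nat.cast_nonneg _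
        linarith
      have hH0 : 0 ≤ H := le_trans (by positivity) hA
      calc opQNorm (T i) * (16 * ((threshold n i : ℝ) / n)) ^ α
          ≤ opQNorm (T i) * (144 * (t / n)) ^ α := by
            have : 16 * ((threshold n i : ℝ) / n) ≤ 144 * (t / n) := by
              rw [← mul_div_assoc, ← mul_div_assoc]
              exact div_le_div_of_nonneg_right (by linarith) hn0.le
            gcongr
        _ = 144 ^ α * (opQNorm (T i) * (t / n) ^ α) := by
            rw [Real.mul_rpow (by norm_num) (by positivity)]
            ring
        _ ≤ 144 ^ (1 / P) * H := by gcongr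
        _ ≤ 2 * 144 ^ (1 / P) * H := by
            have : 0 ≤ 144 ^ (1 / P) * H := by positivity
            linarith
    · have hκ : threshold n i = 5 := by
        rw [threshold, Nat.div_eq_of_lt (by omega)]
        simp
      have hA := (le_quantityA (T := T) α (n := n) (i := ⟨n - 1, by omega⟩)
        (by simp only; omega) (by simp only; omega)).trans hAH
      have hlog : Real.logb 2 (2 * ((n - 1 + 1 : ℕ) : ℝ) / n) = 1 := by
        rw [Nat.sub_add_cancel hn, mul_div_assoc, div_self hn0.ne', mul_one,
          Real.logb_self_eq_one (by norm_num)]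
      simp only [hlog] at hA
      have hTn := opQNorm_nonneg r (T := T ⟨n - 1, by omega⟩)
      have hi0 := (hmono ⟨0, by omega⟩ i (Fin.le_def.2 (Nat.zero_le _))).trans h2
      calc opQNorm (T i) * (16 * ((threshold n i : ℝ) / n)) ^ α
          ≤ (2 * opQNorm (T ⟨n - 1, by omega⟩)) * (144 * (1 / n)) ^ α := by
            have : 16 * ((threshold n i : ℝ) / n) ≤ 144 * (1 / n) := by
              rw [hκ, ← mul_div_assoc, ← mul_div_assoc]
              exact div_le_div_of_nonneg_right (by norm_num) hn0.le
            gcongr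
        _ = 2 * 144 ^ α * (opQNorm (T ⟨n - 1, by omega⟩) * (1 / n) ^ α) := by
            rw [Real.mul_rpow (by norm_num) (by positivity)]
            ring
        _ ≤ 2 * 144 ^ (1 / P) * H := by gcongr
  have hH0 : 0 ≤ H := by
    have h1 := hsmall ⟨0, by omega⟩
    have h3 : 0 ≤ 2 * (144 : ℝ) ^ (1 / P) * H :=
      le_trans (mul_nonneg (opQNorm_nonneg r) (by positivity)) h1
    exact nonneg_of_mul_nonneg_right h3 (by positivity)
  have hex : ∀ δ : ℝ, 0 < δ → ∀ (i : Fin m) (k : ℕ), ∃ S : Finset (Y i), S.card ≤ 2 ^ (0 + k) ∧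
      (k = 0 → 0 ∈ S) ∧ (1 ≤ k → k ≤ n → ∀ x : X i, ‖x‖ ^ P ≤ 64 * ((k : ℝ) / n) →
        ∃ c ∈ S, ‖T i x - c‖ ≤ 64 ^ (1 / P) * (H + δ) * ((k : ℝ) / n) ^ β) := by
    intro δ hδ i k
    by_cases hk : 1 ≤ k ∧ k ≤ n
    · obtain ⟨S, hS, hSc⟩ := (hT i).exists_cover_level r hp hα hk.1 hk.2 hδ
        ((le_quantityB α hk.1 hk.2 i).trans (le_max_right _ _))
      exact ⟨S, hS.trans (Nat.pow_le_pow_right (by norm_num) (by omega)), by omega,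
        fun _ _ => hSc⟩
    · exact ⟨{0}, by simpa using Nat.one_le_two_pow, by simp, fun h h' => absurd ⟨h, h'⟩ hk⟩
  have hδ : ∀ δ : ℝ, 0 < δ → entropyNumber n (diagOp p q T)
      ≤ 2 * 144 ^ (1 / P) * (H + δ) * 3 ^ β := by
    intro δ hδ
    choose S hS hS0 hSk using hex δ hδ
    refine entropyNumber_diagOp_le r hp hq hn (fun i => threshold n i) (fun _ => 0) (by simp)
      (sum_threshold_le hn) S hS (by positivity) (fun _ => 0) (by simp) (by simp) ?_
    intro i x hx
    have hx0 := RBanachSpace.norm_nonneg 𝕜 r x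
    have hw0 : 0 ≤ ‖x‖ ^ P := Real.rpow_nonneg hx0 _
    have hw1 : ‖x‖ ^ P ≤ 1 := Real.rpow_le_one hx0 hx hp.le
    rw [add_zero]
    rcases level_cases hn (threshold n i) (‖x‖ ^ P) with ⟨hκ, hw⟩ | ⟨hk, hw⟩
    · have hle := level_le (n := n) (κ := threshold n i) hw0
      set k := level n (threshold n i) (‖x‖ ^ P)
      have hk1 : 1 ≤ k := le_trans (by unfold threshold; omega) hκ
      have hk1' : (1 : ℝ) ≤ k := by exact_mod_cast hk1
      have hkw : (k : ℝ) / n ≤ ‖x‖ ^ P := by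
        rw [div_le_iff₀ hn0]
        nlinarith
      have hkn : k ≤ n := by
        have : (k : ℝ) ≤ n := (div_le_one hn0).1 (hkw.trans hw1)
        exact_mod_cast this
      obtain ⟨c, hc, hxc⟩ := hSk i k hk1 hkn x (hw.trans (by
        rw [← mul_div_assoc, ← mul_div_assoc]
        exact div_le_div_of_nonneg_right (by linarith) hn0.le))
      refine ⟨c, hc, hxc.trans ?_⟩
      have h64 : (64 : ℝ) ^ (1 / P) ≤ 2 * 144 ^ (1 / P) := by
        have : (64 : ℝ) ^ (1 / P) ≤ 144 ^ (1 / P) :=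
          Real.rpow_le_rpow (by norm_num) (by norm_num) (by positivity)
        have h0 : (0 : ℝ) ≤ 144 ^ (1 / P) := by positivity
        linarith
      gcongr
    · refine ⟨0, hS0 i _ hk, ?_⟩
      rw [sub_zero]
      have hsplit : ‖x‖ = (‖x‖ ^ P) ^ α * (‖x‖ ^ P) ^ β := by
        rw [← Real.rpow_add_of_nonneg hw0 hα hβ0, hαβ, Real.rpow_rpow_inv hx0 hp.ne']
      calc ‖T i x‖ ≤ opQNorm (T i) * ‖x‖ := (hT i).norm_apply_le r x
        _ = opQNorm (T i) * (‖x‖ ^ P) ^ α * (‖x‖ ^ P) ^ β := by rw [mul_assoc, ← hsplit]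
        _ ≤ opQNorm (T i) * (16 * ((threshold n i : ℝ) / n)) ^ α * (‖x‖ ^ P) ^ β := by
            have := opQNorm_nonneg r (T := T i)
            gcongr
        _ ≤ 2 * 144 ^ (1 / P) * (H + δ) * (‖x‖ ^ P) ^ β := by
            refine mul_le_mul_of_nonneg_right ((hsmall i).trans ?_) (by positivity)
            gcongr
            linarith
  set c₂ : ℝ := 2 * 144 ^ (1 / P) * 3 ^ β with hc₂
  have hc₂0 : 0 < c₂ := by positivity
  refine le_of_forall_pos_le_add fun ε hε => (hδ (ε / c₂) (by positivity)).trans_eq ?_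
  rw [mul_right_comm, ← hc₂, mul_add, mul_div_cancel₀ _ hc₂0.ne']

end NormDecreasing

/-! ### Equal operators -/

section Const

variable {𝕜 : Type w} [RCLike 𝕜] {X : Type u} {Y : Type v}
  [AddCommGroup X] [Module 𝕜 X] [Norm X] [AddCommGroup Y] [Module 𝕜 Y] [Norm Y] {T₀ : X →ₗ[𝕜] Y}

theorem le_quantityD (α : ℝ) {a : ℝ} {n k : ℕ} (hk : 1 ≤ k) (hkn : k ≤ n) (hak : a ≤ k) :
    ((k : ℝ) / n) ^ α * entropyNumber k T₀ ≤ quantityD α a n T₀ := by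
  refine le_csSup (Set.Finite.bddAbove ?_) ⟨k, hk, hkn, hak, rfl⟩
  refine (Set.finite_range fun z : Fin (n + 1) =>
    (((z : ℕ) : ℝ) / n) ^ α * entropyNumber z T₀).subset ?_
  rintro _ ⟨k, -, hkn, -, rfl⟩
  exact ⟨⟨k, by omega⟩, rfl⟩

theorem quantityD_nonneg (α a : ℝ) (n : ℕ) : 0 ≤ quantityD α a n T₀ := by
  refine Real.sSup_nonneg ?_
  rintro _ ⟨k, -, -, -, rfl⟩
  exact mul_nonneg (by positivity) (entropyNumber_nonneg _ _)

variable (r : ℝ) [RBanachSpace 𝕜 r X] [RBanachSpace 𝕜 r Y] {p q : ℝ≥0∞}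

theorem quantityD_le (hp : 0 < p.toReal) (hq : 0 < q) (hα : 0 ≤ expGap p q) (hr : 0 < r) {m n : ℕ}
    (hm : 1 ≤ m) (hmn : m ≤ n) (hT : IsBoundedOp T₀) :
    2 ^ (-(1 / r)) * 4 ^ (-(q⁻¹).toReal) * 5 ^ (-expGap p q) *
        quantityD (expGap p q) (16 * (n : ℝ) / m) n T₀
      ≤ entropyNumber n (diagOp p q fun _ : Fin m => T₀) := by
  set c : ℝ := 2 ^ (-(1 / r)) * 4 ^ (-(q⁻¹).toReal) * 5 ^ (-expGap p q) with hc
  have hc0 : 0 < c := by positivity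
  have hn : 1 ≤ n := hm.trans hmn
  rw [← le_div_iff₀' hc0]
  refine Real.sSup_le ?_ (div_nonneg (entropyNumber_nonneg _ _) hc0.le)
  rintro _ ⟨k, hk1, hkn, hk, rfl⟩
  have hy : 0 < ((k : ℝ) / n) ^ expGap p q := by positivity
  rw [← le_div_iff₀' hy]
  refine le_of_forall_lt_imp_le_of_dense fun ε hε => ?_
  rw [le_div_iff₀' hy, le_div_iff₀' hc0]
  rcases le_or_gt ε 0 with h0 | h0
  · exact (mul_nonpos_of_nonneg_of_nonpos hc0.le
      (mul_nonpos_of_nonneg_of_nonpos hy.le h0)).trans (entropyNumber_nonneg _ _)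
  · refine le_trans (le_of_eq ?_)
      (le_entropyNumber_diagOp_const r hp hq hα hr hn hm hmn hkn hk hT h0 hε)
    rw [hc]
    ring

include r in
/-- Every coordinate is covered with at least `k₀ ≈ n / (8 m)` bits, at the cost of `n / 8` bits in
total, and the coordinates of mass above `64 k₀ / n` receive more. -/
theorem entropyNumber_diagOp_const_le (hp : 0 < p.toReal) (hq : 0 < q) (hα : 0 ≤ expGap p q)
    {m n : ℕ} (hm : 1 ≤ m) (hmn : m ≤ n) (hT : IsBoundedOp T₀) :
    entropyNumber n (diagOp p q fun _ : Fin m => T₀) ≤ 64 ^ (1 / p.toReal) * 3 ^ (q⁻¹).toReal *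
      quantityD (expGap p q) (1 / 8 * (n : ℝ) / m) n T₀ := by
  classical
  have hn : 1 ≤ n := hm.trans hmn
  have hn0 : (0 : ℝ) < n := by exact_mod_cast hn
  have hm0 : (0 : ℝ) < m := by exact_mod_cast hm
  have hm1 : (1 : ℝ) ≤ m := by exact_mod_cast hm
  have hmn' : (m : ℝ) ≤ n := by exact_mod_cast hmn
  set P := p.toReal
  set β := (q⁻¹).toReal with hβ
  have hβ0 : 0 ≤ β := ENNReal.toReal_nonneg
  set a : ℝ := 1 / 8 * (n : ℝ) / m with ha
  set k₀ : ℕ := ⌈a⌉₊ with hk₀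
  have ha0 : 0 < a := by positivity
  have hk₀1 : 1 ≤ k₀ := Nat.ceil_pos.2 ha0
  have hak₀ : a ≤ k₀ := Nat.le_ceil a
  have hk₀a : (k₀ : ℝ) < a + 1 := Nat.ceil_lt_add_one ha0.le
  have ham : a * m = n / 8 := by
    rw [ha, div_mul_cancel₀ _ hm0.ne']
    ring
  have hk₀n : k₀ ≤ n := by
    rw [hk₀, Nat.ceil_le, ha, div_le_iff₀ hm0]
    nlinarith
  have hmk₀ : m * (k₀ : ℝ) ≤ 2 * n := by nlinarith
  set H := quantityD (expGap p q) a n T₀ with hH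
  have hH0 : 0 ≤ H := quantityD_nonneg _ _ _
  have hex : ∀ δ : ℝ, 0 < δ → ∀ k : ℕ, ∃ S : Finset Y, S.card ≤ 2 ^ (k - 1) ∧
      (k₀ ≤ k → k ≤ n → ∀ x : X, ‖x‖ ^ P ≤ 64 * ((k : ℝ) / n) →
        ∃ c ∈ S, ‖T₀ x - c‖ ≤ 64 ^ (1 / P) * (H + δ) * ((k : ℝ) / n) ^ β) := by
    intro δ hδ k
    by_cases hk : k₀ ≤ k ∧ k ≤ n
    · obtain ⟨S, hS, hSc⟩ := hT.exists_cover_level r hp hα (hk₀1.trans hk.1) hk.2 hδ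
        (le_quantityD (T₀ := T₀) (expGap p q) (hk₀1.trans hk.1) hk.2 (hak₀.trans (by
          exact_mod_cast hk.1)))
      exact ⟨S, hS, fun _ _ => hSc⟩
    · exact ⟨∅, by simp, fun h h' => absurd ⟨h, h'⟩ hk⟩
  have hδ : ∀ δ : ℝ, 0 < δ → entropyNumber n (diagOp p q fun _ : Fin m => T₀)
      ≤ 64 ^ (1 / P) * (H + δ) * 3 ^ β := by
    intro δ hδ
    choose S hS hSk using hex δ hδ
    refine entropyNumber_diagOp_le r hp hq hn (fun _ => 4 * k₀) (fun _ => k₀ - 1) ?_ ?_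
      (fun _ k => if k = 0 then S k₀ else S k) ?_ (by positivity) (fun _ => (k₀ : ℝ) / n)
      (fun _ => by positivity) ?_ ?_
    · rw [Finset.sum_const, Finset.card_univ, Fintype.card_fin, smul_eq_mul]
      have h : 8 * ((m : ℝ) * ((k₀ - 1 : ℕ) : ℝ)) ≤ n := by
        rw [Nat.cast_sub hk₀1, Nat.cast_one]
        nlinarith
      exact_mod_cast h
    · rw [Finset.sum_const, Finset.card_univ, Fintype.card_fin, nsmul_eq_mul]
      have h : (1 / 2 : ℝ) ^ (4 * k₀) ≤ (1 / 2) ^ 4 :=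
        pow_le_pow_of_le_one (by norm_num) (by norm_num) (by omega)
      have h' := mul_le_mul_of_nonneg_left h hm0.le
      norm_num at h' ⊢
      linarith
    · intro _ k
      split_ifs with hk
      · exact (hS k₀).trans (Nat.pow_le_pow_right (by norm_num) (by omega))
      · exact (hS k).trans (Nat.pow_le_pow_right (by norm_num) (by omega))
    · rw [Finset.sum_const, Finset.card_univ, Fintype.card_fin, nsmul_eq_mul, ← mul_div_assoc,
        div_le_iff₀ hn0]
      exact hmk₀
    · intro _ x hx
      have hx0 := RBanachSpace.norm_nonneg 𝕜 r x
      have hw0 : 0 ≤ ‖x‖ ^ P := Real.rpow_nonneg hx0 _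
      have hw1 : ‖x‖ ^ P ≤ 1 := Real.rpow_le_one hx0 hx hp.le
      have hd0 : 0 ≤ (k₀ : ℝ) / n := by positivity
      rcases level_cases hn (4 * k₀) (‖x‖ ^ P) with ⟨hκ, hw⟩ | ⟨hk, hw⟩
      · have hle := level_le (n := n) (κ := 4 * k₀) hw0
        set k := level n (4 * k₀) (‖x‖ ^ P)
        have hk1' : (1 : ℝ) ≤ k := by exact_mod_cast (by omega : 1 ≤ k)
        have hkw : (k : ℝ) / n ≤ ‖x‖ ^ P := by
          rw [div_le_iff₀ hn0]
          nlinarith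
        have hkn : k ≤ n := by
          have : (k : ℝ) ≤ n := (div_le_one hn0).1 (hkw.trans hw1)
          exact_mod_cast this
        obtain ⟨c, hc, hxc⟩ := hSk k (by omega) hkn x (hw.trans (by
          rw [← mul_div_assoc, ← mul_div_assoc]
          exact div_le_div_of_nonneg_right (by linarith) hn0.le))
        refine ⟨c, by rwa [if_neg (by omega)], hxc.trans ?_⟩
        gcongr
        linarith
      · obtain ⟨c, hc, hxc⟩ := hSk k₀ le_rfl hk₀n x (hw.trans_eq (by push_cast; ring))
        refine ⟨c, by rwa [if_pos hk], hxc.trans ?_⟩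
        gcongr
        linarith
  set c₆ : ℝ := 64 ^ (1 / P) * 3 ^ β with hc₆
  have hc₆0 : 0 < c₆ := by positivity
  refine le_of_forall_pos_le_add fun ε hε => (hδ (ε / c₆) (by positivity)).trans_eq ?_
  rw [mul_right_comm, ← hc₆, mul_add, mul_div_cancel₀ _ hc₆0.ne']

end Const

/-! ### The two-sided estimates -/

theorem theorem3p3 :
    -- part (i)
    (∀ p q : ℝ≥0∞, 0 < p → p < q →
      ∃ c₂ : ℝ, 0 < c₂ ∧ ∀ r : ℝ, 0 < r → r ≤ 1 → ∃ c₁ : ℝ, 0 < c₁ ∧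
        ∀ (𝕜 : Type w) [RCLike 𝕜] (m n : ℕ) (hn : 1 ≤ n) (_ : m ≤ 2 ^ n) (hm : 2 * n ≤ m)
          (X : Fin m → Type u) (Y : Fin m → Type v)
          [∀ i, AddCommGroup (X i)] [∀ i, Module 𝕜 (X i)] [∀ i, Norm (X i)]
          [∀ i, AddCommGroup (Y i)] [∀ i, Module 𝕜 (Y i)] [∀ i, Norm (Y i)]
          [∀ i, RBanachSpace 𝕜 r (X i)] [∀ i, RBanachSpace 𝕜 r (Y i)]
          (T : ∀ i, X i →ₗ[𝕜] Y i),
          (∀ i, IsBoundedOp (T i)) →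
          (∀ i j : Fin m, i ≤ j → opQNorm (T j) ≤ opQNorm (T i)) →
          opQNorm (T ⟨0, by omega⟩) ≤ 2 * opQNorm (T ⟨n - 1, by omega⟩) →
          c₁ * quantityA (expGap p q) n T ≤ entropyNumber n (diagOp p q T) ∧
          entropyNumber n (diagOp p q T) ≤
            c₂ * max (quantityA (expGap p q) n T) (quantityB (expGap p q) n T)) ∧
    -- part (ii)
    (∃ c₃ c₄ : ℝ, 0 < c₃ ∧ 0 < c₄ ∧ ∀ p q : ℝ≥0∞, 0 < p → p < q →
      ∃ c₆ : ℝ, 0 < c₆ ∧ ∀ r : ℝ, 0 < r → r ≤ 1 → ∃ c₅ : ℝ, 0 < c₅ ∧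
        ∀ (𝕜 : Type w) [RCLike 𝕜] (m n : ℕ) (_ : 1 ≤ m) (_ : m ≤ n)
          (X : Type u) (Y : Type v)
          [AddCommGroup X] [Module 𝕜 X] [Norm X] [AddCommGroup Y] [Module 𝕜 Y] [Norm Y]
          [RBanachSpace 𝕜 r X] [RBanachSpace 𝕜 r Y]
          (T₀ : X →ₗ[𝕜] Y),
          IsBoundedOp T₀ →
          c₅ * quantityD (expGap p q) (c₃ * (n : ℝ) / (m : ℝ)) n T₀ ≤
            entropyNumber n (diagOp p q fun _ : Fin m => T₀) ∧
          entropyNumber n (diagOp p q fun _ : Fin m => T₀) ≤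
            c₆ * quantityD (expGap p q) (c₄ * (n : ℝ) / (m : ℝ)) n T₀) := by
  have hfin : ∀ {p q : ℝ≥0∞}, 0 < p → p < q → 0 < p.toReal := fun hp hpq =>
    ENNReal.toReal_pos hp.ne' (hpq.trans_le le_top).ne
  refine ⟨fun p q hp hpq => ?_, 16, 1 / 8, by norm_num, by norm_num, fun p q hp hpq => ?_⟩
  · refine ⟨2 * 144 ^ (1 / p.toReal) * 3 ^ (q⁻¹).toReal, by positivity, fun r hr _ =>
      ⟨2 ^ (-(1 / r)) * 4 ^ (-(q⁻¹).toReal) * 5 ^ (-expGap p q) / 80, by positivity, ?_⟩⟩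
    intro 𝕜 _ m n hn hmn hm X Y _ _ _ _ _ _ _ _ T hT hmono h2
    exact ⟨quantityA_le r (hfin hp hpq) (hp.trans hpq) (expGap_pos hp hpq).le hr hn hT hmono,
      entropyNumber_diagOp_le_max r (hfin hp hpq) (hp.trans hpq) (expGap_pos hp hpq).le hn
        (by omega) hmn hT hmono h2⟩
  · refine ⟨64 ^ (1 / p.toReal) * 3 ^ (q⁻¹).toReal, by positivity, fun r hr _ =>
      ⟨2 ^ (-(1 / r)) * 4 ^ (-(q⁻¹).toReal) * 5 ^ (-expGap p q), by positivity, ?_⟩⟩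
    intro 𝕜 _ m n hm hmn X Y _ _ _ _ _ _ _ _ T₀ hT
    exact ⟨quantityD_le r (hfin hp hpq) (hp.trans hpq) (expGap_pos hp hpq).le hr hm hmn hT,
      entropyNumber_diagOp_const_le r (hfin hp hpq) (hp.trans hpq) (expGap_pos hp hpq).le hm hmn
        hT⟩
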